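/- Assume the Lindelöf Hypothesis: for every $\varepsilon>0$, $\zeta(\tfrac12+it)\ll_\varepsilon t^{\varepsilon}$ as $t\to\infty$. Let $X=(x_n)_{n\ge 1}$ be a sequence of positive real numbers such that $x_{n+1}-x_n\ge c$ for some constant $c>0$ and all $n\ge1$, and $x_n\ll n^{C}$ for some constant $C$. Write $\|y\|=\min_{k\in\mathbb Z}|y-k|$, and for $N\ge 2$ and $\alpha\in\mathbb R$ put $$\delta_{\min}^{\alpha}(N)=\min\{\|\alpha x_m-\alpha x_n\| : 1\le m,n\le N,\ m\ne n\},$$ $$E^*(X,N)=\#\{(n_1,n_2,n_3,n_4)\in\{1,\dots,N\}^4 : |x_{n_1}+x_{n_2}-x_{n_3}-x_{n_4}|<1\}.$$ (a) Let $\beta\in\mathbb R$ be such that $E^*(X,N)\ll_\varepsilon N^{\beta+\varepsilon}$ for every $\varepsilon>0$. Then for almost every $\alpha\in\mathbb R$ (with respect to Lebesgue measure) there is a sequence $\eta(N)\to0$, which may depend on $\alpha$, such that $$\delta_{\min}^{\alpha}(N)<\frac1{N^{4-\beta-\eta(N)}}\qquad\text{for all } N\ge2.$$ (b) In particular, if $E^*(X,N)\ll_\varepsilon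 N^{2+\varepsilon}$ for every $\varepsilon>0$ (equivalently, $E^*(X,N)=N^{2+o(1)}$), then for almost every $\alpha\in\mathbb R$ there is a sequence $\eta(N)\to0$, which may depend on $\alpha$, such that $$\delta_{\min}^{\alpha}(N)=\frac1{N^{2+\eta(N)}}\qquad\text{for all } N\ge2.$$ -/

import Mathlib

open Filter Topology MeasureTheory Asymptotics

noncomputable section

/-- The Lindelöf Hypothesis: `ζ(1/2 + it) ≪ t^ε` as `t → ∞`, for every `ε > 0`. -/
def LindelofHypothesis : Prop :=
  ∀ ε : ℝ, 0 < ε →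
    (fun t : ℝ => riemannZeta (1 / 2 + (t : ℂ) * Complex.I)) =O[atTop] (fun t : ℝ => t ^ ε)

/-- The distance from a real number to the nearest integer. -/
def distInt (x : ℝ) : ℝ := |x - (round x : ℝ)|

/-- `distInt x` is the minimum of `|x - k|` over the integers `k`. -/
theorem isLeast_distInt (x : ℝ) : IsLeast (Set.range fun k : ℤ => |x - (k : ℝ)|) (distInt x) := by
  refine ⟨⟨round x, rfl⟩, ?_⟩
  rintro _ ⟨k, rfl⟩
  exact round_le x k

/-- The pairwise distances modulo one between the first `N` terms `y 1, …, y N` of a sequence.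
(Sequences are indexed by the integers `n ≥ 1`; the value `y 0` is never used.) -/
def gapSet (y : ℕ → ℝ) (N : ℕ) : Set ℝ :=
  {d | ∃ m ∈ Finset.Icc 1 N, ∃ n ∈ Finset.Icc 1 N, m ≠ n ∧ d = distInt (y m - y n)}

/-- The minimal gap modulo one of the first `N` terms of a sequence. It is a minimum over a
nonempty finite set as soon as `2 ≤ N`. -/
def minGap (y : ℕ → ℝ) (N : ℕ) : ℝ := sInf (gapSet y N)

/-- For `2 ≤ N` the infimum in `minGap` is attained. -/
theorem isLeast_minGap (y : ℕ → ℝ) {N : ℕ} (hN : 2 ≤ N) :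
    IsLeast (gapSet y N) (minGap y N) := by
  have hne : (gapSet y N).Nonempty :=
    ⟨_, 1, Finset.mem_Icc.2 ⟨le_rfl, by omega⟩, 2, Finset.mem_Icc.2 ⟨by omega, hN⟩,
      by omega, rfl⟩
  have hfin : (gapSet y N).Finite := by
    refine (((Finset.Icc 1 N) ×ˢ (Finset.Icc 1 N)).finite_toSet.image
      (fun p : ℕ × ℕ => distInt (y p.1 - y p.2))).subset ?_
    rintro d ⟨m, hm, n, hn, -, rfl⟩
    exact ⟨(m, n), Finset.mem_coe.2 (Finset.mem_product.2 ⟨hm, hn⟩), rfl⟩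
  exact ⟨hne.csInf_mem hfin, fun d hd => csInf_le hfin.bddBelow hd⟩

/-- The additive energy at scale `γ`: the number of quadruples
`(n₁, n₂, n₃, n₄) ∈ [1, N]⁴` with `|x n₁ + x n₂ - x n₃ - x n₄| < γ`. -/
def additiveEnergyAt (x : ℕ → ℝ) (N : ℕ) (γ : ℝ) : ℕ :=
  ((Finset.Icc 1 N ×ˢ Finset.Icc 1 N ×ˢ Finset.Icc 1 N ×ˢ Finset.Icc 1 N).filter
    fun p : ℕ × ℕ × ℕ × ℕ => |x p.1 + x p.2.1 - x p.2.2.1 - x p.2.2.2| < γ).card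

/-- The additive energy `E*(X, N)`, which is the energy at scale `1`. -/
def additiveEnergy (x : ℕ → ℝ) (N : ℕ) : ℕ := additiveEnergyAt x N 1

/-- `E*(X, N) ≪ N^(β + ε)` for every `ε > 0`, with an implied constant depending on `ε`. -/
def EnergyBound (x : ℕ → ℝ) (β : ℝ) : Prop :=
  ∀ ε : ℝ, 0 < ε →
    (fun N : ℕ => (additiveEnergy x N : ℝ)) =O[atTop] (fun N : ℕ => (N : ℝ) ^ (β + ε))

end

/-!
With `y = -log u`, the fractional part of `u`, suitably normalized, has the Fourier transform
`-ζ(s)/s` on the line `Re s = 1/2`. Hence the error in approximating the number of integers in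
`(u, e^τ u]` by the length of this interval has the transform `((e^(τs) - 1)/s) ζ(s)`, whose
multiplier is dominated by a Lorentzian of width `1/τ`. If all gaps of `αx` modulo one are at least
`δ`, then no interval `(αz, e^τ αz]` with `z = x m - x n > 0` and `αz` much smaller than `δ/τ`
contains an integer, so the error is as large as possible for all these `z` simultaneously.

Under the Lindelöf Hypothesis, Plancherel's theorem bounds the mean square of the sum of the errors
over a dyadic family of differences `z` by a Lorentzian mean square of an exponential sum with the
frequencies `log z`. That mean square counts close pairs of logarithms, hence close pairs of
differences, and is governed by the additive energy. By Markov's inequality the set of bad `α` is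
small; the Borel-Cantelli lemma along the powers of two, together with the monotonicity of the
minimal gap, gives the upper bound. The lower bound in the second part comes from a union bound
over all pairs and the same Borel-Cantelli argument.
-/

open scoped FourierTransform

section Fourier

variable {V E : Type*} [NormedAddCommGroup V] [InnerProductSpace ℝ V] [FiniteDimensional ℝ V]
  [MeasurableSpace V] [BorelSpace V] [NormedAddCommGroup E] [NormedSpace ℂ E]

theorem fourier_comp_sub (f : V → E) (a ξ : V) :
    𝓕 (fun y => f (y - a)) ξ = 𝐞 (-inner ℝ a ξ) • 𝓕 f ξ := by
  have h := congrFun (VectorFourier.fourierIntegral_comp_add_right 𝐞 volume (innerₗ V) f (-a)) ξ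
  simp only [map_neg, LinearMap.neg_apply, innerₗ_apply_apply] at h
  simp only [sub_eq_add_neg]
  exact h

theorem fourier_fun_sub {f g : V → E} (hf : Integrable f) (hg : Integrable g) (ξ : V) :
    𝓕 (fun y => f y - g y) ξ = 𝓕 f ξ - 𝓕 g ξ := by
  simp only [Real.fourier_eq, smul_sub]
  exact integral_sub ((Real.fourierIntegral_convergent_iff ξ).2 hf)
    ((Real.fourierIntegral_convergent_iff ξ).2 hg)

theorem fourier_finsetSum {ι : Type*} (S : Finset ι) {f : ι → V → E}
    (hf : ∀ i ∈ S, Integrable (f i)) (ξ : V) :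
    𝓕 (fun y => ∑ i ∈ S, f i y) ξ = ∑ i ∈ S, 𝓕 (f i) ξ := by
  simp only [Real.fourier_eq, Finset.smul_sum]
  exact integral_finsetSum S fun i hi => (Real.fourierIntegral_convergent_iff ξ).2 (hf i hi)

theorem fourier_fun_const_smul (c : ℂ) (f : V → E) (ξ : V) :
    𝓕 (fun y => c • f y) ξ = c • 𝓕 f ξ :=
  congrFun (VectorFourier.fourierIntegral_const_smul 𝐞 volume (innerₗ V) f c) ξ

end Fourier

section Plancherel

variable {V F : Type*} [NormedAddCommGroup V] [InnerProductSpace ℝ V] [FiniteDimensional ℝ V]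
  [MeasurableSpace V] [BorelSpace V] [NormedAddCommGroup F] [InnerProductSpace ℂ F]
  {f : V → F}

theorem continuous_fourier_of_integrable (hf : Integrable f) : Continuous (𝓕 f) :=
  VectorFourier.fourierIntegral_continuous Real.continuous_fourierChar continuous_inner hf

variable [CompleteSpace F]

open SchwartzMap in
theorem fourier_toLp_ae_eq (hf : Integrable f) (hf₂ : MemLp f 2) :
    (𝓕 (hf₂.toLp f) : Lp F 2 (volume : Measure V)) =ᵐ[volume] 𝓕 f := by
  refine ae_eq_of_integral_contDiff_smul_eq ((Lp.memLp _).locallyIntegrable (by norm_num))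
    (continuous_fourier_of_integrable hf).locallyIntegrable fun g hg hgs => ?_
  let φ : 𝓢(V, ℂ) := HasCompactSupport.toSchwartzMap
    (f := fun x => (g x : ℂ)) (hgs.comp_left (g := fun r : ℝ => (r : ℂ)) (by simp))
    (Complex.ofRealCLM.contDiff.comp hg)
  have hφ : ∀ (G : V → F) x, g x • G x = φ x • G x := fun G x =>
    RCLike.real_smul_eq_coe_smul (K := ℂ) (g x) (G x)
  calc ∫ x, g x • (𝓕 (hf₂.toLp f) : Lp F 2 (volume : Measure V)) x
      = ∫ x, φ x • (𝓕 (hf₂.toLp f) : Lp F 2 (volume : Measure V)) x := by simp only [hφ]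
    _ = ∫ x, (𝓕 φ) x • (hf₂.toLp f) x := by
        have h := congrArg (fun T => T φ) (Lp.fourier_toTemperedDistribution_eq (hf₂.toLp f))
        simp only [TemperedDistribution.fourier_apply, Lp.toTemperedDistribution_apply] at h
        exact h.symm
    _ = ∫ x, (𝓕 (φ : V → ℂ)) x • f x := by
        refine integral_congr_ae ?_
        filter_upwards [hf₂.coeFn_toLp] with x hx
        rw [hx, SchwartzMap.fourier_coe]
    _ = ∫ x, φ x • 𝓕 f x := by
        have h := VectorFourier.integral_fourierIntegral_smul_eq_flip (L := innerₗ V) (μ := volume)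
          (ν := volume) Real.continuous_fourierChar continuous_inner φ.integrable hf
        rwa [flip_innerₗ] at h
    _ = ∫ x, g x • 𝓕 f x := by simp only [hφ]

theorem memLp_two_fourier (hf : Integrable f) (hf₂ : MemLp f 2) : MemLp (𝓕 f) 2 :=
  (Lp.memLp _).ae_eq (fourier_toLp_ae_eq hf hf₂)

theorem integral_norm_fourier_sq (hf : Integrable f) (hf₂ : MemLp f 2) :
    ∫ ξ, ‖𝓕 f ξ‖ ^ 2 = ∫ y, ‖f y‖ ^ 2 := by
  have h := Lp.norm_fourier_eq (hf₂.toLp f)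
  rw [Lp.norm_def, Lp.norm_def, eLpNorm_congr_ae (fourier_toLp_ae_eq hf hf₂),
    eLpNorm_congr_ae hf₂.coeFn_toLp,
    (memLp_two_fourier hf hf₂).eLpNorm_eq_integral_rpow_norm two_ne_zero ENNReal.ofNat_ne_top,
    hf₂.eLpNorm_eq_integral_rpow_norm two_ne_zero ENNReal.ofNat_ne_top,
    ENNReal.toReal_ofReal (by positivity), ENNReal.toReal_ofReal (by positivity)] at h
  simpa only [ENNReal.toReal_ofNat, Real.rpow_ofNat] using
    (Real.rpow_left_inj (by positivity) (by positivity) (by norm_num)).1 h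

end Plancherel

section Zeta

/-- The fractional part restricted to `(1, ∞)`. Its Mellin transform converges in the whole
half-plane to which the formula for `ζ` is continued. -/
noncomputable def fractTail : ℝ → ℂ :=
  (Set.Ioi 1).indicator fun u => ((Int.fract u : ℝ) : ℂ)

theorem norm_fract_le_one (u : ℝ) : ‖((Int.fract u : ℝ) : ℂ)‖ ≤ 1 := by
  rw [Complex.norm_real, Real.norm_eq_abs, Int.abs_fract]
  exact (Int.fract_lt_one u).le

theorem norm_fractTail_le_one (u : ℝ) : ‖fractTail u‖ ≤ 1 :=
  (norm_indicator_le_norm_self _ u).trans (norm_fract_le_one u)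

theorem locallyIntegrable_fractTail : LocallyIntegrable fractTail :=
  (locallyIntegrable_const (1 : ℝ)).mono
    ((by fun_prop : Measurable fun u : ℝ => ((Int.fract u : ℝ) : ℂ)).indicator
      measurableSet_Ioi).aestronglyMeasurable
    (Eventually.of_forall fun u => by simpa using norm_fractTail_le_one u)

theorem fractTail_isBigO_atTop : fractTail =O[atTop] fun u : ℝ => u ^ (-(0 : ℝ)) :=
  .of_bound 1 (Eventually.of_forall fun u => by simpa using norm_fractTail_le_one u)

theorem fractTail_isBigO_nhdsGT_zero (b : ℝ) : fractTail =O[𝓝[>] 0] fun u : ℝ => u ^ (-b) := by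
  refine .of_bound 1 ?_
  filter_upwards [mem_nhdsWithin_of_mem_nhds (Iio_mem_nhds one_pos)] with u hu
  rw [fractTail, Set.indicator_of_notMem (by simpa using le_of_lt hu), norm_zero]
  positivity

theorem mellinConvergent_fractTail {s : ℂ} (hs : 0 < s.re) : MellinConvergent fractTail (-s) :=
  mellinConvergent_of_isBigO_rpow (locallyIntegrable_fractTail.locallyIntegrableOn _)
    fractTail_isBigO_atTop (by simpa using hs) (fractTail_isBigO_nhdsGT_zero (-s.re - 1)) (by simp)

theorem differentiableAt_mellin_fractTail {s : ℂ} (hs : 0 < s.re) :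
    DifferentiableAt ℂ (mellin fractTail) (-s) :=
  mellin_differentiableAt_of_isBigO_rpow (locallyIntegrable_fractTail.locallyIntegrableOn _)
    fractTail_isBigO_atTop (by simpa using hs) (fractTail_isBigO_nhdsGT_zero (-s.re - 1)) (by simp)

theorem integrableOn_cpow_mul_fract {s : ℂ} (hs : 0 < s.re) :
    IntegrableOn (fun t : ℝ => (t : ℂ) ^ (-s - 1) * ((Int.fract t : ℝ) : ℂ)) (Set.Ioi 1) :=
  ((mellinConvergent_fractTail hs).mono_set (Set.Ioi_subset_Ioi zero_le_one)).congr_fun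
    (fun t ht => by simp only [fractTail, Set.indicator_of_mem ht, smul_eq_mul]) measurableSet_Ioi

theorem mellin_fractTail (s : ℂ) :
    mellin fractTail s = ∫ t in Set.Ioi (1 : ℝ), (t : ℂ) ^ (s - 1) * ((Int.fract t : ℝ) : ℂ) := by
  have h (t : ℝ) : (t : ℂ) ^ (s - 1) • fractTail t = (Set.Ioi (1 : ℝ)).indicator
      (fun t : ℝ => (t : ℂ) ^ (s - 1) * ((Int.fract t : ℝ) : ℂ)) t :=
    (Set.indicator_mul_right _ (fun t : ℝ => (t : ℂ) ^ (s - 1)) _).symm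
  rw [mellin, funext h, setIntegral_indicator measurableSet_Ioi,
    Set.inter_eq_right.2 (Set.Ioi_subset_Ioi zero_le_one)]

theorem riemannZeta_eq_mul_integral_floor {s : ℂ} (hs : 1 < s.re) :
    riemannZeta s = s * ∫ t in Set.Ioi (1 : ℝ), (⌊t⌋₊ : ℂ) * (t : ℂ) ^ (-(s + 1)) := by
  have h := LSeries_eq_mul_integral_of_nonneg (fun _ => 1) zero_le_one hs
    (.of_bound 1 (Eventually.of_forall fun n => by simp)) fun _ => zero_le_one
  simpa [show (fun _ : ℕ => (1 : ℂ)) = 1 from rfl, LSeries_one_eq_riemannZeta hs] using h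

theorem integral_floor_mul_cpow {s : ℂ} (hs : 1 < s.re) :
    ∫ t in Set.Ioi (1 : ℝ), (⌊t⌋₊ : ℂ) * (t : ℂ) ^ (-(s + 1)) =
      1 / (s - 1) - mellin fractTail (-s) := by
  have hs' : (-s).re < -1 := by simpa using hs
  have hpow : ∫ t in Set.Ioi (1 : ℝ), (t : ℂ) ^ (-s) = 1 / (s - 1) := by
    rw [integral_Ioi_cpow_of_lt hs' one_pos, Complex.ofReal_one, Complex.one_cpow,
      neg_div, ← div_neg, neg_add', neg_neg]
  rw [mellin_fractTail, ← hpow,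
    ← integral_sub (integrableOn_Ioi_cpow_of_lt hs' one_pos)
      (integrableOn_cpow_mul_fract (one_pos.trans hs))]
  refine setIntegral_congr_fun measurableSet_Ioi fun t ht => ?_
  have ht0 : 0 < t := one_pos.trans ht
  have hfloor : (⌊t⌋₊ : ℂ) = t - (Int.fract t : ℝ) := by
    rw [← Complex.ofReal_natCast, natCast_floor_eq_intCast_floor ht0.le, ← Complex.ofReal_sub,
      Int.self_sub_fract]
  have hcpow : (t : ℂ) ^ (-s) = (t : ℂ) ^ (-s - 1) * t := by
    rw [Complex.cpow_sub _ _ (by exact_mod_cast ht0.ne'), Complex.cpow_one,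
      div_mul_cancel₀ _ (by exact_mod_cast ht0.ne')]
  simp only [hfloor, hcpow, neg_add']
  ring

theorem riemannZeta₀_eq_of_one_lt_re {s : ℂ} (hs : 1 < s.re) :
    riemannZeta₀ s = 1 - s * mellin fractTail (-s) := by
  have hs1 : s ≠ 1 := by rintro rfl; simp at hs
  have h := riemannZeta_eq_inv_sub_add hs1
  rw [riemannZeta_eq_mul_integral_floor hs, integral_floor_mul_cpow hs] at h
  have : s - 1 ≠ 0 := sub_ne_zero.2 hs1
  rw [← sub_eq_iff_eq_add'.2 h]
  field_simp
  ring

theorem riemannZeta₀_eq {s : ℂ} (hs : 0 < s.re) :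
    riemannZeta₀ s = 1 - s * mellin fractTail (-s) := by
  have hopen : IsOpen {s : ℂ | 0 < s.re} := isOpen_lt continuous_const Complex.continuous_re
  have hmellin : AnalyticOnNhd ℂ (fun s => 1 - s * mellin fractTail (-s)) {s : ℂ | 0 < s.re} :=
    DifferentiableOn.analyticOnNhd (fun s hs => ((differentiableAt_id.mul
      ((differentiableAt_mellin_fractTail hs).comp s differentiableAt_id.neg)).const_sub
        1).differentiableWithinAt) hopen
  refine (differentiable_riemannZeta₀.differentiableOn.analyticOnNhd
    hopen).eqOn_of_preconnected_of_eventuallyEq hmellin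
    (convex_halfSpace_re_gt 0).isPreconnected (z₀ := 2) (by simp) ?_ hs
  filter_upwards [(isOpen_lt continuous_const Complex.continuous_re).mem_nhds
    (show (1 : ℝ) < (2 : ℂ).re by norm_num)] with z hz
  exact riemannZeta₀_eq_of_one_lt_re hz

theorem mellin_fract {s : ℂ} (hs₀ : 0 < s.re) (hs₁ : s.re < 1) :
    mellin (fun u => ((Int.fract u : ℝ) : ℂ)) (-s) = -(riemannZeta s / s) := by
  have hs0 : s ≠ 0 := by rintro rfl; simp at hs₀
  have hs1 : s ≠ 1 := by rintro rfl; simp at hs₁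
  obtain ⟨hc, hv⟩ := hasMellin_cpow_Ioc 1 (s := -s) (by simpa using hs₁)
  have hsplit : mellin (fun u => ((Int.fract u : ℝ) : ℂ)) (-s) = mellin (fun t => fractTail t +
      (Set.Ioc (0 : ℝ) 1).indicator (fun t : ℝ => (t : ℂ) ^ (1 : ℂ)) t) (-s) := by
    refine setIntegral_congr_ae measurableSet_Ioi ?_
    filter_upwards [compl_mem_ae_iff.2 (measure_singleton (1 : ℝ))] with t ht ht0
    congr 1
    rcases lt_or_gt_of_ne (show t ≠ 1 from ht) with h | h
    · rw [fractTail, Set.indicator_of_notMem (by simpa using h.le),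
        Set.indicator_of_mem (Set.mem_Ioc.2 ⟨ht0, h.le⟩), Int.fract_eq_self.2 ⟨le_of_lt ht0, h⟩]
      simp
    · rw [fractTail, Set.indicator_of_mem (Set.mem_Ioi.2 h),
        Set.indicator_of_notMem (by simp [h]), add_zero]
  rw [hsplit, (hasMellin_add (mellinConvergent_fractTail hs₀) hc).2, hv,
    riemannZeta_eq_inv_sub_add hs1, riemannZeta₀_eq hs₀]
  have h₁ : -s + 1 ≠ 0 := fun h => hs1 (by linear_combination -h)
  have h₂ : s - 1 ≠ 0 := sub_ne_zero.2 hs1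
  field_simp
  ring

end Zeta

section ExpSum

variable {ι : Type*} (S : Finset ι) (ℓ : ι → ℝ)

/-- The exponential sum with frequencies `ℓ i`, for `i ∈ S`: the factor by which the Fourier
transform changes when a function is replaced by the sum of its translates by the `ℓ i`. -/
noncomputable def expSum (ξ : ℝ) : ℂ := ∑ i ∈ S, (𝐞 (-(ℓ i * ξ)) : ℂ)

theorem norm_expSum_le (ξ : ℝ) : ‖expSum S ℓ ξ‖ ≤ S.card := by
  simpa only [expSum, Circle.norm_coe, Finset.sum_const, nsmul_eq_mul, mul_one] using
    norm_sum_le S fun i => (𝐞 (-(ℓ i * ξ)) : ℂ)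

variable {f : ℝ → ℂ}

theorem integrable_sum_translates (hf : Integrable f) :
    Integrable fun y => ∑ i ∈ S, f (y - ℓ i) :=
  integrable_finsetSum _ fun i _ => hf.comp_sub_right (ℓ i)

theorem memLp_comp_sub {p : ENNReal} (hf : MemLp f p) (a : ℝ) : MemLp (fun y => f (y - a)) p :=
  hf.comp_measurePreserving (measurePreserving_sub_right volume a)

theorem memLp_sum_translates {p : ENNReal} (hf : MemLp f p) :
    MemLp (fun y => ∑ i ∈ S, f (y - ℓ i)) p :=
  memLp_finsetSum _ fun i _ => memLp_comp_sub hf (ℓ i)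

theorem fourier_sum_translates (hf : Integrable f) (ξ : ℝ) :
    𝓕 (fun y => ∑ i ∈ S, f (y - ℓ i)) ξ = expSum S ℓ ξ * 𝓕 f ξ := by
  rw [fourier_finsetSum S fun i _ => hf.comp_sub_right (ℓ i), expSum, Finset.sum_mul]
  refine Finset.sum_congr rfl fun i _ => ?_
  rw [fourier_comp_sub, Circle.smul_def, smul_eq_mul, real_inner_comm, RCLike.inner_apply,
    conj_trivial]

theorem integral_norm_expSum_mul_fourier_sq (hf : Integrable f) (hf₂ : MemLp f 2) :
    ∫ ξ, ‖expSum S ℓ ξ * 𝓕 f ξ‖ ^ 2 = ∫ y, ‖∑ i ∈ S, f (y - ℓ i)‖ ^ 2 := by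
  simp only [← fourier_sum_translates S ℓ hf]
  exact integral_norm_fourier_sq (integrable_sum_translates S ℓ hf) (memLp_sum_translates S ℓ hf₂)

end ExpSum

section Lorentzian

/-- The Lorentzian of width `1 / τ`. -/
noncomputable def lorentzian (τ ξ : ℝ) : ℝ := τ ^ 2 / (1 + (2 * Real.pi * τ * ξ) ^ 2)

/-- The one-sided exponential of decay length `τ`, whose Fourier transform has the Lorentzian as
the square of its modulus. -/
noncomputable def decayExp (τ : ℝ) : ℝ → ℝ :=
  (Set.Ioi 0).indicator fun y => Real.exp (-τ⁻¹ * y)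

variable {τ : ℝ}

theorem lorentzian_nonneg (τ ξ : ℝ) : 0 ≤ lorentzian τ ξ := by unfold lorentzian; positivity

theorem integrable_decayExp (hτ : 0 < τ) : Integrable (decayExp τ) :=
  (integrable_indicator_iff measurableSet_Ioi).2
    (integrableOn_exp_mul_Ioi (by simpa using hτ) 0)

theorem decayExp_mul_decayExp (a b y : ℝ) :
    decayExp τ (y - a) * decayExp τ (y - b) = (Set.Ioi (max a b)).indicator
      (fun y => Real.exp (τ⁻¹ * (a + b)) * Real.exp (-(2 * τ⁻¹) * y)) y := by
  simp only [decayExp, Set.indicator, Set.mem_Ioi, sub_pos, max_lt_iff,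
    ite_zero_mul_ite_zero]
  congr 1
  rw [← Real.exp_add, ← Real.exp_add]
  ring_nf

theorem integrable_decayExp_mul (hτ : 0 < τ) (a b : ℝ) :
    Integrable fun y => decayExp τ (y - a) * decayExp τ (y - b) := by
  simp only [decayExp_mul_decayExp]
  exact (integrable_indicator_iff measurableSet_Ioi).2
    ((integrableOn_exp_mul_Ioi (by simpa using hτ) _).const_mul _)

theorem integral_decayExp_mul (hτ : 0 < τ) (a b : ℝ) :
    ∫ y, decayExp τ (y - a) * decayExp τ (y - b) = τ / 2 * Real.exp (-|a - b| / τ) := by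
  have hexp : τ⁻¹ * (a + b) + -(2 * τ⁻¹) * max a b = -|a - b| / τ := by
    rcases le_total a b with h | h
    · rw [max_eq_right h, abs_of_nonpos (sub_nonpos.2 h)]
      ring
    · rw [max_eq_left h, abs_of_nonneg (sub_nonneg.2 h)]
      ring
  simp only [decayExp_mul_decayExp]
  rw [integral_indicator measurableSet_Ioi, integral_const_mul,
    integral_exp_mul_Ioi (by simpa using hτ), neg_div_neg_eq, mul_div_assoc', ← Real.exp_add, hexp]
  field_simp

theorem memLp_two_decayExp (hτ : 0 < τ) : MemLp (decayExp τ) 2 :=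
  (memLp_two_iff_integrable_sq (integrable_decayExp hτ).1).2 <| by
    simpa [sq] using integrable_decayExp_mul hτ 0 0

theorem fourier_decayExp (hτ : 0 < τ) (ξ : ℝ) :
    𝓕 (fun y => (decayExp τ y : ℂ)) ξ = 1 / ((τ⁻¹ : ℝ) + (2 * Real.pi * ξ : ℝ) * Complex.I) := by
  have h (y : ℝ) : Complex.exp ((-2 * Real.pi * y * ξ : ℝ) * Complex.I) • (decayExp τ y : ℂ) =
      (Set.Ioi (0 : ℝ)).indicator
        (fun y : ℝ => Complex.exp (-((τ⁻¹ : ℝ) + (2 * Real.pi * ξ : ℝ) * Complex.I) * y)) y := by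
    simp only [decayExp, Set.indicator]
    split_ifs
    · rw [smul_eq_mul, Complex.ofReal_exp, ← Complex.exp_add]
      push_cast
      ring_nf
    · simp
  rw [Real.fourier_real_eq_integral_exp_smul, funext h, integral_indicator measurableSet_Ioi,
    integral_exp_mul_complex_Ioi (by simpa using hτ), Complex.ofReal_zero, mul_zero,
    Complex.exp_zero, neg_div_neg_eq]

theorem norm_fourier_decayExp_sq (hτ : 0 < τ) (ξ : ℝ) :
    ‖𝓕 (fun y => (decayExp τ y : ℂ)) ξ‖ ^ 2 = lorentzian τ ξ := by
  rw [fourier_decayExp hτ, norm_div, norm_one, div_pow, one_pow, ← Complex.normSq_eq_norm_sq,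
    Complex.normSq_add_mul_I, lorentzian]
  field_simp

variable {ι : Type*} (S : Finset ι) (ℓ : ι → ℝ)

theorem norm_expSum_mul_fourier_decayExp_sq (hτ : 0 < τ) (ξ : ℝ) :
    ‖expSum S ℓ ξ * 𝓕 (fun y => (decayExp τ y : ℂ)) ξ‖ ^ 2 =
      lorentzian τ ξ * ‖expSum S ℓ ξ‖ ^ 2 := by
  rw [norm_mul, mul_pow, norm_fourier_decayExp_sq hτ, mul_comm]

theorem integrable_lorentzian_mul_norm_expSum_sq (hτ : 0 < τ) :
    Integrable fun ξ => lorentzian τ ξ * ‖expSum S ℓ ξ‖ ^ 2 := by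
  have hint : Integrable fun y => (decayExp τ y : ℂ) := (integrable_decayExp hτ).ofReal
  have hmem : MemLp (fun y => (decayExp τ y : ℂ)) 2 := (memLp_two_decayExp hτ).ofReal
  simpa only [fourier_sum_translates S ℓ hint, norm_expSum_mul_fourier_decayExp_sq S ℓ hτ] using
    (memLp_two_fourier (integrable_sum_translates S ℓ hint)
      (memLp_sum_translates S ℓ hmem)).integrable_norm_pow two_ne_zero

theorem integral_lorentzian_mul_norm_expSum_sq (hτ : 0 < τ) :
    ∫ ξ, lorentzian τ ξ * ‖expSum S ℓ ξ‖ ^ 2 =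
      τ / 2 * ∑ i ∈ S, ∑ j ∈ S, Real.exp (-|ℓ i - ℓ j| / τ) := by
  have hsq (y : ℝ) : ‖∑ i ∈ S, (decayExp τ (y - ℓ i) : ℂ)‖ ^ 2 =
      ∑ i ∈ S, ∑ j ∈ S, decayExp τ (y - ℓ i) * decayExp τ (y - ℓ j) := by
    rw [← Complex.ofReal_sum, Complex.norm_real, Real.norm_eq_abs, sq_abs, sq, Finset.sum_mul_sum]
  calc ∫ ξ, lorentzian τ ξ * ‖expSum S ℓ ξ‖ ^ 2
      = ∫ y, ∑ i ∈ S, ∑ j ∈ S, decayExp τ (y - ℓ i) * decayExp τ (y - ℓ j) := by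
        simp only [← hsq, ← norm_expSum_mul_fourier_decayExp_sq S ℓ hτ]
        exact integral_norm_expSum_mul_fourier_sq S ℓ (integrable_decayExp hτ).ofReal
          (memLp_two_decayExp hτ).ofReal
    _ = ∑ i ∈ S, ∑ j ∈ S, ∫ y, decayExp τ (y - ℓ i) * decayExp τ (y - ℓ j) := by
        rw [integral_finsetSum _ fun i _ => integrable_finsetSum _ fun j _ =>
          integrable_decayExp_mul hτ _ _]
        exact Finset.sum_congr rfl fun i _ =>
          integral_finsetSum _ fun j _ => integrable_decayExp_mul hτ _ _
    _ = τ / 2 * ∑ i ∈ S, ∑ j ∈ S, Real.exp (-|ℓ i - ℓ j| / τ) := by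
        simp only [integral_decayExp_mul hτ, Finset.mul_sum]

end Lorentzian

section CriticalLine

/-- The point `1 / 2 - 2πiξ`, at which the Mellin transform of a function of `u` is the Fourier
transform at `ξ` of the normalised function of `y = -log u`. -/
noncomputable def criticalPoint (ξ : ℝ) : ℂ := (1 / 2 : ℝ) - (2 * Real.pi * ξ : ℝ) * Complex.I

theorem re_criticalPoint (ξ : ℝ) : (criticalPoint ξ).re = 1 / 2 := by simp [criticalPoint]

theorem im_criticalPoint (ξ : ℝ) : (criticalPoint ξ).im = -(2 * Real.pi * ξ) := by
  simp [criticalPoint]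

theorem norm_criticalPoint_pos (ξ : ℝ) : 0 < ‖criticalPoint ξ‖ :=
  norm_pos_iff.2 fun h => by simpa [h] using re_criticalPoint ξ

theorem exists_norm_le_mul_one_add_rpow {E : Type*} [SeminormedAddCommGroup E] {f : ℝ → E}
    (hf : Continuous f) {ε : ℝ} (hε : 0 ≤ ε) (h : f =O[atTop] fun t : ℝ => t ^ ε) :
    ∃ C : ℝ, 0 < C ∧ ∀ t, 0 ≤ t → ‖f t‖ ≤ C * (1 + t) ^ ε := by
  obtain ⟨C, hC, hbound⟩ := h.exists_pos
  obtain ⟨T, hT⟩ := eventually_atTop.1 hbound.bound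
  obtain ⟨M, hM⟩ := (isCompact_Icc (a := (0 : ℝ)) (b := T)).exists_bound_of_continuousOn
    hf.continuousOn
  refine ⟨max C M, lt_max_of_lt_left hC, fun t ht => ?_⟩
  rcases le_total t T with htT | htT
  · calc ‖f t‖ ≤ max C M * 1 := by simpa using Or.inr (hM t ⟨ht, htT⟩)
      _ ≤ max C M * (1 + t) ^ ε := by
        gcongr
        exact Real.one_le_rpow (by linarith) hε
  · calc ‖f t‖ ≤ C * t ^ ε := by
          simpa [Real.norm_of_nonneg (Real.rpow_nonneg ht ε)] using hT t htT
      _ ≤ max C M * (1 + t) ^ ε := by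
        gcongr
        exacts [le_max_left C M, by linarith]

theorem continuous_riemannZeta_criticalLine :
    Continuous fun t : ℝ => riemannZeta (1 / 2 + (t : ℂ) * Complex.I) := by
  refine continuous_iff_continuousAt.2 fun t => ?_
  refine ContinuousAt.comp (g := riemannZeta) ?_ (by fun_prop)
  refine (differentiableAt_riemannZeta fun h => ?_).continuousAt
  have := congrArg Complex.re h
  norm_num at this

theorem norm_riemannZeta_criticalPoint (ξ : ℝ) :
    ‖riemannZeta (criticalPoint ξ)‖ =
      ‖riemannZeta (1 / 2 + ((2 * Real.pi * |ξ| : ℝ) : ℂ) * Complex.I)‖ := by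
  rcases le_total 0 ξ with h | h
  · rw [abs_of_nonneg h, ← Complex.norm_conj, ← riemannZeta_conj]
    simp [criticalPoint, Complex.conj_ofNat]
  · rw [abs_of_nonpos h, criticalPoint]
    push_cast
    ring_nf

theorem LindelofHypothesis.exists_norm_riemannZeta_criticalPoint_le (hLH : LindelofHypothesis)
    {ε : ℝ} (hε : 0 < ε) :
    ∃ C : ℝ, 0 < C ∧ ∀ ξ : ℝ, ‖riemannZeta (criticalPoint ξ)‖ ≤ C * (1 + |ξ|) ^ ε := by
  obtain ⟨C, hC, hζ⟩ := exists_norm_le_mul_one_add_rpow continuous_riemannZeta_criticalLine hε.le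
    (hLH ε hε)
  refine ⟨C * (2 * Real.pi) ^ ε, by positivity, fun ξ => ?_⟩
  rw [norm_riemannZeta_criticalPoint]
  calc _ ≤ C * (1 + 2 * Real.pi * |ξ|) ^ ε := hζ _ (by positivity)
    _ ≤ C * (2 * Real.pi * (1 + |ξ|)) ^ ε := by
      gcongr
      linarith [Real.pi_gt_three]
    _ = C * (2 * Real.pi) ^ ε * (1 + |ξ|) ^ ε := by
      rw [Real.mul_rpow (by positivity) (by positivity), mul_assoc]

end CriticalLine

section WindowError

/-- The fractional part of `u` divided by `√u`, as a function of `y = -log u`. -/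
noncomputable def logFract (y : ℝ) : ℂ := (Real.exp (y / 2) * Int.fract (Real.exp (-y)) : ℝ)

theorem measurable_logFract : Measurable logFract := by
  unfold logFract
  fun_prop

theorem fourier_logFract (ξ : ℝ) :
    𝓕 logFract ξ = -(riemannZeta (criticalPoint ξ) / criticalPoint ξ) := by
  rw [← mellin_fract (by simp [re_criticalPoint]) (by norm_num [re_criticalPoint]),
    mellin_eq_fourier, Complex.neg_re, Complex.neg_im, re_criticalPoint, im_criticalPoint, neg_neg,
    neg_neg, mul_div_cancel_left₀ ξ (by positivity)]
  refine congrArg (fun f : ℝ → ℂ => 𝓕 f ξ) (funext fun y => ?_)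
  rw [logFract, Complex.real_smul, Complex.ofReal_mul, one_div_mul_eq_div]

theorem norm_logFract_le (y : ℝ) : ‖logFract y‖ ≤ Real.exp (-(1 / 2) * |y|) := by
  rw [logFract, Complex.norm_real, norm_mul, Real.norm_of_nonneg (Real.exp_pos _).le,
    Real.norm_of_nonneg (Int.fract_nonneg _)]
  rcases le_total 0 y with hy | hy
  · calc _ ≤ Real.exp (y / 2) * Real.exp (-y) := by
          gcongr
          exact sub_le_self _ (Int.cast_nonneg (Int.floor_nonneg.2 (Real.exp_pos _).le))
      _ = _ := by rw [← Real.exp_add, abs_of_nonneg hy]; ring_nf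
  · calc _ ≤ Real.exp (y / 2) * 1 := by
          gcongr
          exact (Int.fract_lt_one _).le
      _ = _ := by rw [mul_one, abs_of_nonpos hy]; ring_nf

theorem integrable_exp_neg_mul_abs {c : ℝ} (hc : 0 < c) :
    Integrable fun y : ℝ => Real.exp (-c * |y|) := by
  rw [← integrableOn_univ, ← Set.Iic_union_Ioi (a := (0 : ℝ))]
  refine IntegrableOn.union ?_ ?_
  · refine (integrableOn_exp_mul_Iic hc 0).congr_fun (fun y hy => ?_) measurableSet_Iic
    simp only [abs_of_nonpos (Set.mem_Iic.1 hy), neg_mul_neg]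
  · refine (integrableOn_exp_mul_Ioi (neg_lt_zero.2 hc) 0).congr_fun (fun y hy => ?_)
      measurableSet_Ioi
    simp only [abs_of_pos (Set.mem_Ioi.1 hy)]

theorem integrable_logFract : Integrable logFract :=
  (integrable_exp_neg_mul_abs (c := 1 / 2) (by norm_num)).mono'
    measurable_logFract.aestronglyMeasurable (Eventually.of_forall norm_logFract_le)

theorem memLp_two_logFract : MemLp logFract 2 := by
  refine (memLp_two_iff_integrable_sq_norm measurable_logFract.aestronglyMeasurable).2 ?_
  refine (integrable_exp_neg_mul_abs one_pos).mono'
    (measurable_logFract.norm.pow_const 2).aestronglyMeasurable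
    (Eventually.of_forall fun y => ?_)
  rw [Real.norm_of_nonneg (by positivity)]
  calc ‖logFract y‖ ^ 2 ≤ Real.exp (-(1 / 2) * |y|) ^ 2 := by gcongr; exact norm_logFract_le y
    _ = Real.exp (-1 * |y|) := by rw [← Real.exp_nat_mul]; ring_nf

/-- The error in approximating the number of integers in `(u, e^τ u]` by the length of this
interval, divided by `√u`, as a function of `y = -log u`. -/
noncomputable def windowError (τ y : ℝ) : ℂ :=
  logFract y - (Real.exp (τ / 2) : ℂ) • logFract (y - τ)

theorem windowError_eq (τ y : ℝ) : windowError τ y =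
    (Real.exp (y / 2) * ((⌊Real.exp τ * Real.exp (-y)⌋ - ⌊Real.exp (-y)⌋ : ℝ) -
      (Real.exp τ - 1) * Real.exp (-y)) : ℝ) := by
  have h₁ : Real.exp (τ / 2) * Real.exp ((y - τ) / 2) = Real.exp (y / 2) := by
    rw [← Real.exp_add]
    ring_nf
  have h₂ : Real.exp (-(y - τ)) = Real.exp τ * Real.exp (-y) := by
    rw [← Real.exp_add]
    ring_nf
  rw [windowError, logFract, logFract, smul_eq_mul, ← Complex.ofReal_mul, ← mul_assoc, h₁, h₂,
    ← Complex.ofReal_sub, Int.fract, Int.fract]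
  ring_nf

theorem measurable_windowError (τ : ℝ) : Measurable (windowError τ) :=
  measurable_logFract.sub
    ((measurable_logFract.comp (measurable_sub_const τ)).const_smul (Real.exp (τ / 2) : ℂ))

theorem integrable_smul_logFract_sub (τ : ℝ) :
    Integrable fun y => (Real.exp (τ / 2) : ℂ) • logFract (y - τ) :=
  (integrable_logFract.comp_sub_right τ).smul (Real.exp (τ / 2) : ℂ)

theorem integrable_windowError (τ : ℝ) : Integrable (windowError τ) :=
  integrable_logFract.sub (integrable_smul_logFract_sub τ)

theorem memLp_two_windowError (τ : ℝ) : MemLp (windowError τ) 2 :=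
  memLp_two_logFract.sub
    ((memLp_comp_sub memLp_two_logFract τ).const_smul (Real.exp (τ / 2) : ℂ))

theorem fourier_windowError (τ ξ : ℝ) : 𝓕 (windowError τ) ξ =
    (Complex.exp (τ * criticalPoint ξ) - 1) / criticalPoint ξ *
      riemannZeta (criticalPoint ξ) := by
  have hexp : (Real.exp (τ / 2) : ℂ) * (𝐞 (-inner ℝ τ ξ) : ℂ) =
      Complex.exp (τ * criticalPoint ξ) := by
    rw [Real.fourierChar_apply, Complex.ofReal_exp, ← Complex.exp_add, criticalPoint,
      RCLike.inner_apply, conj_trivial]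
    push_cast
    ring_nf
  unfold windowError
  rw [fourier_fun_sub integrable_logFract (integrable_smul_logFract_sub τ),
    fourier_fun_const_smul, fourier_comp_sub, Circle.smul_def, smul_smul, hexp, fourier_logFract,
    smul_eq_mul]
  ring

end WindowError

section SecondMoment

variable {τ ε R : ℝ}

theorem norm_exp_sub_one_sq_mul_le {z : ℂ} (hz : z.re ≤ 1) :
    ‖Complex.exp z - 1‖ ^ 2 * (1 + ‖z‖ ^ 2) ≤ 32 * ‖z‖ ^ 2 := by
  rcases le_total ‖z‖ 1 with h | h
  · calc ‖Complex.exp z - 1‖ ^ 2 * (1 + ‖z‖ ^ 2) ≤ (2 * ‖z‖) ^ 2 * (1 + 1) := by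
          gcongr
          exacts [Complex.norm_exp_sub_one_le h, pow_le_one₀ (norm_nonneg z) h]
      _ ≤ 32 * ‖z‖ ^ 2 := by linarith [sq_nonneg ‖z‖]
  · have hexp : ‖Complex.exp z - 1‖ ≤ 4 := by
      calc ‖Complex.exp z - 1‖ ≤ Real.exp z.re + 1 := by
            simpa [Complex.norm_exp] using norm_sub_le (Complex.exp z) 1
        _ ≤ Real.exp 1 + 1 := by gcongr
        _ ≤ 4 := by linarith [Real.exp_one_lt_d9]
    calc ‖Complex.exp z - 1‖ ^ 2 * (1 + ‖z‖ ^ 2) ≤ 4 ^ 2 * (‖z‖ ^ 2 + ‖z‖ ^ 2) := by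
          gcongr
          exact one_le_pow₀ h
      _ = 32 * ‖z‖ ^ 2 := by ring

theorem norm_windowMultiplier_sq_le (hτ : 0 < τ) (hτ₂ : τ ≤ 2) (ξ : ℝ) :
    ‖(Complex.exp (τ * criticalPoint ξ) - 1) / criticalPoint ξ‖ ^ 2 ≤ 32 * lorentzian τ ξ := by
  have hs := norm_criticalPoint_pos ξ
  have hnorm : ‖(τ : ℂ) * criticalPoint ξ‖ = τ * ‖criticalPoint ξ‖ := by
    rw [norm_mul, Complex.norm_real, Real.norm_of_nonneg hτ.le]
  have him : (2 * Real.pi * τ * ξ) ^ 2 ≤ ‖(τ : ℂ) * criticalPoint ξ‖ ^ 2 := by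
    rw [← sq_abs]
    gcongr
    calc |2 * Real.pi * τ * ξ| = |((τ : ℂ) * criticalPoint ξ).im| := by
          rw [Complex.im_ofReal_mul, im_criticalPoint, ← abs_neg]
          ring_nf
      _ ≤ _ := Complex.abs_im_le_norm _
  rw [lorentzian, norm_div, div_pow, mul_div_assoc', div_le_div_iff₀ (by positivity)
    (by positivity)]
  calc ‖Complex.exp (τ * criticalPoint ξ) - 1‖ ^ 2 * (1 + (2 * Real.pi * τ * ξ) ^ 2)
      ≤ ‖Complex.exp (τ * criticalPoint ξ) - 1‖ ^ 2 * (1 + ‖(τ : ℂ) * criticalPoint ξ‖ ^ 2) := by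
        gcongr
    _ ≤ 32 * ‖(τ : ℂ) * criticalPoint ξ‖ ^ 2 := norm_exp_sub_one_sq_mul_le <| by
        rw [Complex.re_ofReal_mul, re_criticalPoint]
        linarith
    _ = 32 * τ ^ 2 * ‖criticalPoint ξ‖ ^ 2 := by rw [hnorm]; ring

theorem lorentzian_le (hτ₁ : |τ| ≤ 1) (ξ : ℝ) :
    lorentzian τ ξ ≤ 2 * (1 + |ξ|) ^ (-2 : ℝ) := by
  have hτ_sq : τ ^ 2 ≤ 1 := (sq_le_one_iff_abs_le_one τ).2 hτ₁
  have hπ : 1 ≤ (2 * Real.pi) ^ 2 := one_le_pow₀ (by linarith [Real.pi_gt_three])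
  rw [Real.rpow_neg (by positivity), lorentzian, ← div_eq_mul_inv,
    div_le_div_iff₀ (by positivity) (by positivity), Real.rpow_two]
  calc τ ^ 2 * (1 + |ξ|) ^ 2 ≤ τ ^ 2 * (2 * (1 + ξ ^ 2)) := by
        gcongr
        linarith [add_sq_le (a := 1) (b := |ξ|), sq_abs ξ]
    _ = 2 * (τ ^ 2 + 1 * (τ ^ 2 * ξ ^ 2)) := by ring
    _ ≤ 2 * (1 + (2 * Real.pi) ^ 2 * (τ ^ 2 * ξ ^ 2)) := by gcongr
    _ = 2 * (1 + (2 * Real.pi * τ * ξ) ^ 2) := by ring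

theorem rpow_le_rpow_sub_mul {u a b : ℝ} (hR : 0 < R) (hRu : R ≤ u) (hab : a ≤ b) :
    u ^ a ≤ R ^ (a - b) * u ^ b := by
  have hu : 0 < u := hR.trans_le hRu
  calc u ^ a = u ^ (a - b) * u ^ b := by rw [← Real.rpow_add hu, sub_add_cancel]
    _ ≤ R ^ (a - b) * u ^ b := mul_le_mul_of_nonneg_right
      (Real.rpow_le_rpow_of_nonpos hR hRu (sub_nonpos.2 hab)) (by positivity)

theorem rpow_mul_lorentzian_le (hτ₁ : |τ| ≤ 1) (hε : 0 ≤ ε) (hε₄ : ε ≤ 1 / 4) (hR : 0 < R)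
    (ξ : ℝ) :
    (1 + |ξ|) ^ (2 * ε) * lorentzian τ ξ ≤
      R ^ (2 * ε) *
        (lorentzian τ ξ + 2 * R ^ (-(1 / 2) : ℝ) * (1 + |ξ|) ^ (-(3 / 2) : ℝ)) := by
  have hL := lorentzian_nonneg τ ξ
  rcases le_total (1 + |ξ|) R with h | h
  · calc (1 + |ξ|) ^ (2 * ε) * lorentzian τ ξ ≤ R ^ (2 * ε) * lorentzian τ ξ := by gcongr
      _ ≤ _ := by
        gcongr
        exact le_add_of_nonneg_right (by positivity)
  · calc (1 + |ξ|) ^ (2 * ε) * lorentzian τ ξ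
        ≤ R ^ (2 * ε - 1 / 2) * (1 + |ξ|) ^ (1 / 2 : ℝ) * (2 * (1 + |ξ|) ^ (-2 : ℝ)) := by
          gcongr
          exacts [rpow_le_rpow_sub_mul hR h (by linarith), lorentzian_le hτ₁ ξ]
      _ = R ^ (2 * ε) * (2 * R ^ (-(1 / 2) : ℝ) * (1 + |ξ|) ^ (-(3 / 2) : ℝ)) := by
        rw [sub_eq_add_neg, Real.rpow_add hR,
          show (-(3 / 2) : ℝ) = 1 / 2 + -2 by norm_num, Real.rpow_add (by positivity)]
        ring
      _ ≤ _ := by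
        gcongr
        exact le_add_of_nonneg_left hL

variable {ι : Type*} (S : Finset ι) (ℓ : ι → ℝ)

theorem norm_expSum_mul_fourier_windowError_sq_le {C : ℝ}
    (hζ : ∀ ξ, ‖riemannZeta (criticalPoint ξ)‖ ≤ C * (1 + |ξ|) ^ ε) (hε : 0 ≤ ε) (hε₄ : ε ≤ 1 / 4)
    (hτ : 0 < τ) (hτ₁ : τ ≤ 1) (hR : 0 < R) (ξ : ℝ) :
    ‖expSum S ℓ ξ * 𝓕 (windowError τ) ξ‖ ^ 2 ≤
      32 * C ^ 2 * R ^ (2 * ε) * (lorentzian τ ξ * ‖expSum S ℓ ξ‖ ^ 2 +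
        2 * (S.card : ℝ) ^ 2 * R ^ (-(1 / 2) : ℝ) * (1 + |ξ|) ^ (-(3 / 2) : ℝ)) := by
  have hsq : ((1 + |ξ|) ^ ε) ^ 2 = (1 + |ξ|) ^ (2 * ε) := by
    rw [← Real.rpow_mul_natCast (by positivity), mul_comm, Nat.cast_two]
  have hL₀ := lorentzian_nonneg τ ξ
  have hL : (1 + |ξ|) ^ (2 * ε) * lorentzian τ ξ ≤ _ :=
    rpow_mul_lorentzian_le (abs_le.2 ⟨by linarith, hτ₁⟩) hε hε₄ hR ξ
  rw [fourier_windowError, norm_mul, norm_mul, mul_pow, mul_pow]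
  calc _ ≤ ‖expSum S ℓ ξ‖ ^ 2 * (32 * lorentzian τ ξ * (C * (1 + |ξ|) ^ ε) ^ 2) := by
        gcongr
        exacts [norm_windowMultiplier_sq_le hτ (by linarith) ξ, hζ ξ]
    _ = 32 * C ^ 2 * ‖expSum S ℓ ξ‖ ^ 2 * ((1 + |ξ|) ^ (2 * ε) * lorentzian τ ξ) := by
        rw [mul_pow C, hsq]
        ring
    _ ≤ 32 * C ^ 2 * ‖expSum S ℓ ξ‖ ^ 2 * (R ^ (2 * ε) *
          (lorentzian τ ξ + 2 * R ^ (-(1 / 2) : ℝ) * (1 + |ξ|) ^ (-(3 / 2) : ℝ))) := by gcongr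
    _ = 32 * C ^ 2 * R ^ (2 * ε) * (lorentzian τ ξ * ‖expSum S ℓ ξ‖ ^ 2 +
          2 * ‖expSum S ℓ ξ‖ ^ 2 * R ^ (-(1 / 2) : ℝ) * (1 + |ξ|) ^ (-(3 / 2) : ℝ)) := by ring
    _ ≤ _ := by
        gcongr
        exact norm_expSum_le S ℓ ξ

theorem LindelofHypothesis.integral_norm_sum_windowError_sq_le (hLH : LindelofHypothesis)
    (hε : 0 < ε) (hε₄ : ε ≤ 1 / 4) :
    ∃ C : ℝ, 0 < C ∧ ∀ {ι : Type*} (S : Finset ι) (ℓ : ι → ℝ) (τ R : ℝ),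
      0 < τ → τ ≤ 1 → 0 < R →
      ∫ y, ‖∑ i ∈ S, windowError τ (y - ℓ i)‖ ^ 2 ≤
        C * R ^ (2 * ε) * (τ * ∑ i ∈ S, ∑ j ∈ S, Real.exp (-|ℓ i - ℓ j| / τ) +
          (S.card : ℝ) ^ 2 * R ^ (-(1 / 2) : ℝ)) := by
  obtain ⟨C, hC, hζ⟩ := hLH.exists_norm_riemannZeta_criticalPoint_le hε
  have hint : Integrable fun ξ : ℝ => (1 + |ξ|) ^ (-(3 / 2) : ℝ) :=
    integrable_one_add_norm (by norm_num)
  let K := ∫ ξ : ℝ, (1 + |ξ|) ^ (-(3 / 2) : ℝ)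
  have hK : 0 ≤ K := integral_nonneg fun ξ => by positivity
  refine ⟨32 * C ^ 2 * (1 + 2 * K), by positivity, fun {ι} S ℓ τ R hτ hτ₁ hR => ?_⟩
  let W := ∑ i ∈ S, ∑ j ∈ S, Real.exp (-|ℓ i - ℓ j| / τ)
  have hW : 0 ≤ W := by positivity
  have hD := integrable_lorentzian_mul_norm_expSum_sq S ℓ hτ
  calc ∫ y, ‖∑ i ∈ S, windowError τ (y - ℓ i)‖ ^ 2
      = ∫ ξ, ‖expSum S ℓ ξ * 𝓕 (windowError τ) ξ‖ ^ 2 :=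
        (integral_norm_expSum_mul_fourier_sq S ℓ (integrable_windowError τ)
          (memLp_two_windowError τ)).symm
    _ ≤ ∫ ξ, 32 * C ^ 2 * R ^ (2 * ε) * (lorentzian τ ξ * ‖expSum S ℓ ξ‖ ^ 2 +
          2 * (S.card : ℝ) ^ 2 * R ^ (-(1 / 2) : ℝ) * (1 + |ξ|) ^ (-(3 / 2) : ℝ)) :=
        integral_mono_of_nonneg (Eventually.of_forall fun ξ => by positivity)
          ((hD.add (hint.const_mul _)).const_mul _) (Eventually.of_forall
            (norm_expSum_mul_fourier_windowError_sq_le S ℓ hζ hε.le hε₄ hτ hτ₁ hR))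
    _ = 32 * C ^ 2 * R ^ (2 * ε) *
          (τ / 2 * W + 2 * (S.card : ℝ) ^ 2 * R ^ (-(1 / 2) : ℝ) * K) := by
        rw [integral_const_mul, integral_add hD (hint.const_mul _), integral_const_mul,
          integral_lorentzian_mul_norm_expSum_sq S ℓ hτ]
    _ ≤ 32 * C ^ 2 * R ^ (2 * ε) *
          ((1 + 2 * K) * (τ * W + (S.card : ℝ) ^ 2 * R ^ (-(1 / 2) : ℝ))) := by
        gcongr
        have hW' : 0 ≤ τ * W / 2 + 2 * K * (τ * W) + (S.card : ℝ) ^ 2 * R ^ (-(1 / 2) : ℝ) := by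
          positivity
        linarith
    _ = _ := by ring

end SecondMoment

section EmptyWindows

theorem floor_eq_of_sub_lt_distInt {u v : ℝ} (huv : u ≤ v) (h : v - u < distInt u) :
    ⌊v⌋ = ⌊u⌋ := by
  refine (Int.floor_mono huv).antisymm' (not_lt.1 fun hlt => ?_)
  have hu : u < ⌊v⌋ := Int.floor_lt.1 hlt
  have hdist : distInt u ≤ |u - ⌊v⌋| := round_le u ⌊v⌋
  rw [abs_of_neg (sub_neg.2 hu)] at hdist
  linarith [Int.floor_le v]

theorem volume_exp_neg_image_le {T : Set ℝ} (hT : MeasurableSet T) {K : ℝ}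
    (h : ∀ y ∈ T, Real.exp (-y) ≤ K) :
    volume ((fun y => Real.exp (-y)) '' T) ≤ ENNReal.ofReal K * volume T := by
  have hderiv : ∀ y ∈ T, HasDerivWithinAt (fun y => Real.exp (-y)) (Real.exp (-y) * -1) T y :=
    fun y _ => (hasDerivAt_neg y).exp.hasDerivWithinAt
  have hinj : Set.InjOn (fun y => Real.exp (-y)) T :=
    (Real.exp_injective.comp neg_injective).injOn
  rw [← setLIntegral_one, lintegral_image_eq_lintegral_abs_deriv_mul hT hderiv hinj,
    ← setLIntegral_const]
  refine setLIntegral_mono' hT fun y hy => ?_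
  rw [mul_one, mul_neg_one, abs_neg, abs_of_pos (Real.exp_pos _)]
  exact ENNReal.ofReal_le_ofReal (h y hy)

theorem volume_le_of_le_comp_neg_log {g : ℝ → ℝ} (hgm : Measurable g) (hg₀ : ∀ y, 0 ≤ g y)
    (hg : Integrable g) {K lam : ℝ} (hlam : 0 < lam) {B : Set ℝ} (hB : B ⊆ Set.Ioc 0 K)
    (h : ∀ α ∈ B, lam ≤ g (-Real.log α)) :
    volume B ≤ ENNReal.ofReal (K / lam * ∫ y, g y) := by
  rcases B.eq_empty_or_nonempty with rfl | ⟨α₀, hα₀⟩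
  · simp
  have hK : 0 < K := (hB hα₀).1.trans_le (hB hα₀).2
  let T : Set ℝ := {y | lam ≤ g y} ∩ {y | Real.exp (-y) ≤ K}
  have hT : MeasurableSet T := (measurableSet_le measurable_const hgm).inter
    (measurableSet_le (by fun_prop) measurable_const)
  have hsub : B ⊆ (fun y => Real.exp (-y)) '' T := fun α hα => by
    have hexp : Real.exp (-(-Real.log α)) = α := by rw [neg_neg, Real.exp_log (hB hα).1]
    exact ⟨-Real.log α, ⟨h α hα, hexp.le.trans (hB hα).2⟩, hexp⟩
  have hmarkov : volume.real {y | lam ≤ g y} ≤ (∫ y, g y) / lam := by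
    rw [le_div_iff₀' hlam]
    exact mul_meas_ge_le_integral_of_nonneg (Eventually.of_forall hg₀) hg lam
  calc volume B ≤ ENNReal.ofReal K * volume T :=
        (measure_mono hsub).trans (volume_exp_neg_image_le hT fun y hy => hy.2)
    _ ≤ ENNReal.ofReal K * volume {y | lam ≤ g y} := by
        gcongr
        exact Set.inter_subset_left
    _ = ENNReal.ofReal (K * volume.real {y | lam ≤ g y}) := by
        rw [ENNReal.ofReal_mul hK.le, ofReal_measureReal (hg.measure_ge_lt_top hlam).ne]
    _ ≤ ENNReal.ofReal (K / lam * ∫ y, g y) := by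
        rw [div_mul_eq_mul_div, mul_div_assoc]
        gcongr

theorem windowError_neg_log {τ u : ℝ} (hu : 0 < u) (h : ⌊Real.exp τ * u⌋ = ⌊u⌋) :
    windowError τ (-Real.log u) = (-((Real.exp τ - 1) * √u) : ℝ) := by
  have hhalf : Real.exp (-Real.log u / 2) = (√u)⁻¹ := by
    rw [neg_div, Real.exp_neg, Real.exp_half, Real.exp_log hu]
  rw [windowError_eq, neg_neg, Real.exp_log hu, h, sub_self, zero_sub, hhalf, mul_neg,
    mul_left_comm, ← div_eq_inv_mul, Real.div_sqrt]

variable {ι : Type*} (S : Finset ι)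

theorem card_sq_mul_le_norm_sum_windowError_sq {u : ι → ℝ} {Y τ : ℝ} (hτ : 0 ≤ τ) (hY : 0 < Y)
    (hu : ∀ i ∈ S, Y ≤ u i) (hfloor : ∀ i ∈ S, ⌊Real.exp τ * u i⌋ = ⌊u i⌋) :
    (S.card : ℝ) ^ 2 * τ ^ 2 * Y ≤ ‖∑ i ∈ S, windowError τ (-Real.log (u i))‖ ^ 2 := by
  have hτ_le : τ ≤ Real.exp τ - 1 := by linarith [Real.add_one_le_exp τ]
  have hsum : ‖∑ i ∈ S, windowError τ (-Real.log (u i))‖ =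
      ∑ i ∈ S, (Real.exp τ - 1) * √(u i) := by
    rw [Finset.sum_congr rfl fun i hi => windowError_neg_log (hY.trans_le (hu i hi)) (hfloor i hi),
      ← Complex.ofReal_sum, Complex.norm_real, Finset.sum_neg_distrib, norm_neg,
      Real.norm_of_nonneg (Finset.sum_nonneg fun i _ =>
        mul_nonneg (hτ.trans hτ_le) (Real.sqrt_nonneg _))]
  have hlower : S.card * (τ * √Y) ≤ ∑ i ∈ S, (Real.exp τ - 1) * √(u i) := by
    rw [← nsmul_eq_mul]
    refine Finset.card_nsmul_le_sum _ _ _ fun i hi => ?_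
    gcongr
    exacts [hτ.trans hτ_le, hu i hi]
  calc (S.card : ℝ) ^ 2 * τ ^ 2 * Y = (S.card * (τ * √Y)) ^ 2 := by
        rw [mul_pow, mul_pow, Real.sq_sqrt hY.le, mul_assoc]
    _ ≤ _ := by
        rw [hsum]
        gcongr

theorem volume_le_of_floor_eq (z : ι → ℝ) {Z K τ : ℝ} (hS : S.Nonempty) (hZ : 0 < Z)
    (hz : ∀ i ∈ S, Z ≤ z i) (hK : 0 < K) (hτ : 0 < τ) {B : Set ℝ} (hB : B ⊆ Set.Icc K⁻¹ K)
    (hfloor : ∀ α ∈ B, ∀ i ∈ S, ⌊Real.exp τ * (α * z i)⌋ = ⌊α * z i⌋) :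
    volume B ≤ ENNReal.ofReal (K ^ 2 / ((S.card : ℝ) ^ 2 * τ ^ 2 * Z) *
      ∫ y, ‖∑ i ∈ S, windowError τ (y - Real.log (z i))‖ ^ 2) := by
  have hcard : (0 : ℝ) < S.card := Nat.cast_pos.2 hS.card_pos
  have hmeas : Measurable fun y => ‖∑ i ∈ S, windowError τ (y - Real.log (z i))‖ ^ 2 := by
    have := measurable_windowError τ
    fun_prop
  have hpos : ∀ α ∈ B, 0 < α := fun α hα => (inv_pos.2 hK).trans_le (hB hα).1
  rw [show K ^ 2 / ((S.card : ℝ) ^ 2 * τ ^ 2 * Z) = K / ((S.card : ℝ) ^ 2 * τ ^ 2 * (K⁻¹ * Z)) by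
    field_simp]
  refine volume_le_of_le_comp_neg_log hmeas (fun y => by positivity)
    ((memLp_sum_translates S _ (memLp_two_windowError τ)).integrable_norm_pow two_ne_zero)
    (by positivity) (fun α hα => ⟨hpos α hα, (hB hα).2⟩) fun α hα => ?_
  have hlog : ∀ i ∈ S, -Real.log α - Real.log (z i) = -Real.log (α * z i) := fun i hi => by
    rw [Real.log_mul (hpos α hα).ne' (hZ.trans_le (hz i hi)).ne', neg_add']
  rw [Finset.sum_congr rfl fun i hi => congrArg (windowError τ) (hlog i hi)]
  refine card_sq_mul_le_norm_sum_windowError_sq S hτ.le (by positivity) (fun i hi => ?_)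
    (hfloor α hα)
  exact mul_le_mul (hB hα).1 (hz i hi) hZ.le (hpos α hα).le

end EmptyWindows

section Energy

theorem abs_sub_div_le_abs_log_sub {a b Z : ℝ} (ha : 0 < a) (hb : 0 < b) (haZ : a ≤ Z)
    (hbZ : b ≤ Z) : |a - b| / Z ≤ |Real.log a - Real.log b| := by
  wlog h : b ≤ a generalizing a b
  · rw [abs_sub_comm, abs_sub_comm (Real.log a)]
    exact this hb ha hbZ haZ (le_of_not_ge h)
  rw [abs_of_nonneg (sub_nonneg.2 h), abs_of_nonneg (sub_nonneg.2 (Real.log_le_log hb h)),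
    ← Real.log_div ha.ne' hb.ne']
  calc (a - b) / Z ≤ (a - b) / a := div_le_div_of_nonneg_left (sub_nonneg.2 h) ha haZ
    _ = 1 - (a / b)⁻¹ := by field_simp
    _ ≤ Real.log (a / b) := Real.one_sub_inv_le_log_of_pos (by positivity)

variable (x : ℕ → ℝ) {N : ℕ} {S : Finset (ℕ × ℕ)}

theorem card_close_pairs_le_additiveEnergy (hS : S ⊆ Finset.Icc 1 N ×ˢ Finset.Icc 1 N) :
    ((S ×ˢ S).filter fun q : (ℕ × ℕ) × (ℕ × ℕ) =>
      |(x q.1.1 - x q.1.2) - (x q.2.1 - x q.2.2)| < 1).card ≤ additiveEnergy x N := by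
  refine Finset.card_le_card_of_injOn (fun q => (q.1.1, q.2.2, q.1.2, q.2.1)) ?_ ?_
  · rintro ⟨⟨a, b⟩, ⟨c, d⟩⟩ hq
    simp only [Finset.coe_filter, Finset.mem_product, Set.mem_ofPred_eq] at hq ⊢
    obtain ⟨⟨hab, hcd⟩, hclose⟩ := hq
    obtain ⟨ha, hb⟩ := Finset.mem_product.1 (hS hab)
    obtain ⟨hc, hd⟩ := Finset.mem_product.1 (hS hcd)
    refine ⟨⟨ha, hd, hb, hc⟩, ?_⟩
    rwa [show x a + x d - x b - x c = x a - x b - (x c - x d) by ring]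
  · rintro ⟨⟨a, b⟩, ⟨c, d⟩⟩ _ ⟨⟨a', b'⟩, ⟨c', d'⟩⟩ _ h
    simp only [Prod.mk.injEq] at h ⊢
    tauto

theorem sum_exp_neg_abs_log_sub_le (hS : S ⊆ Finset.Icc 1 N ×ˢ Finset.Icc 1 N) {Z τ w : ℝ}
    (hZ : 0 < Z) (hτ : 0 < τ) (hw : w * (2 * Z * τ) ≤ 1)
    (hz : ∀ p ∈ S, x p.1 - x p.2 ∈ Set.Ico Z (2 * Z)) :
    ∑ p ∈ S, ∑ q ∈ S, Real.exp (-|Real.log (x p.1 - x p.2) - Real.log (x q.1 - x q.2)| / τ) ≤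
      additiveEnergy x N + (S.card : ℝ) ^ 2 * Real.exp (-w) := by
  rw [← Finset.sum_product' (f := fun p q : ℕ × ℕ =>
      Real.exp (-|Real.log (x p.1 - x p.2) - Real.log (x q.1 - x q.2)| / τ)),
    ← Finset.sum_filter_add_sum_filter_not (S ×ˢ S) fun q : (ℕ × ℕ) × (ℕ × ℕ) =>
      |(x q.1.1 - x q.1.2) - (x q.2.1 - x q.2.2)| < 1]
  refine add_le_add ?_ ?_
  · refine (Finset.sum_le_card_nsmul _ _ 1 fun q _ => ?_).trans ?_
    · rw [Real.exp_le_one_iff]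
      exact div_nonpos_of_nonpos_of_nonneg (neg_nonpos.2 (abs_nonneg _)) hτ.le
    · rw [nsmul_eq_mul, mul_one]
      exact_mod_cast card_close_pairs_le_additiveEnergy x hS
  · refine (Finset.sum_le_card_nsmul _ _ (Real.exp (-w)) fun q hq => ?_).trans ?_
    · obtain ⟨hmem, hfar⟩ := Finset.mem_filter.1 hq
      obtain ⟨hp, hq⟩ := Finset.mem_product.1 hmem
      have hlog := abs_sub_div_le_abs_log_sub (hZ.trans_le (hz _ hp).1) (hZ.trans_le (hz _ hq).1)
        (hz _ hp).2.le (hz _ hq).2.le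
      rw [Real.exp_le_exp, neg_div, neg_le_neg_iff, le_div_iff₀ hτ]
      refine le_trans ?_ hlog
      rw [le_div_iff₀ (by positivity)]
      linarith
    · rw [nsmul_eq_mul, sq, ← Nat.cast_mul, ← Finset.card_product]
      gcongr
      exact Finset.filter_subset _ _

end Energy

section LargeGaps

/-- The set of `α` in `[K⁻¹, K]` for which the minimal gap of the first `N` terms of `α x` is at
least `δ`. -/
def largeGapSet (x : ℕ → ℝ) (N : ℕ) (K δ : ℝ) : Set ℝ :=
  {α ∈ Set.Icc K⁻¹ K | δ ≤ minGap (fun n => α * x n) N}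

theorem minGap_le_distInt (y : ℕ → ℝ) {m n N : ℕ} (hm : m ∈ Finset.Icc 1 N)
    (hn : n ∈ Finset.Icc 1 N) (hmn : m ≠ n) : minGap y N ≤ distInt (y m - y n) := by
  have hN : 2 ≤ N := by
    rw [Finset.mem_Icc] at hm hn
    omega
  exact (isLeast_minGap y hN).2 ⟨m, hm, n, hn, hmn, rfl⟩

theorem floor_exp_mul_eq_of_mem_largeGapSet {x : ℕ → ℝ} {m n N : ℕ} {K δ τ α : ℝ}
    (hm : m ∈ Finset.Icc 1 N) (hn : n ∈ Finset.Icc 1 N) (hmn : 0 < x m - x n)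
    (hK : 0 < K) (hτ : 0 ≤ τ) (hτ₁ : τ ≤ 1) (hδ : 2 * τ * (K * (x m - x n)) < δ)
    (hα : α ∈ largeGapSet x N K δ) :
    ⌊Real.exp τ * (α * (x m - x n))⌋ = ⌊α * (x m - x n)⌋ := by
  obtain ⟨⟨hαK, hαK'⟩, hgap⟩ := hα
  have hα₀ : 0 < α := (inv_pos.2 hK).trans_le hαK
  have hne : m ≠ n := fun h => hmn.ne' (by rw [h, sub_self])
  have hexp : Real.exp τ - 1 ≤ 2 * τ := by
    rw [← abs_of_nonneg hτ] at hτ₁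
    simpa only [abs_of_nonneg hτ] using (le_abs_self _).trans (Real.abs_exp_sub_one_le hτ₁)
  refine floor_eq_of_sub_lt_distInt
    (le_mul_of_one_le_left (by positivity) (Real.one_le_exp hτ)) ?_
  calc Real.exp τ * (α * (x m - x n)) - α * (x m - x n)
      = (Real.exp τ - 1) * (α * (x m - x n)) := by ring
    _ ≤ 2 * τ * (K * (x m - x n)) := by gcongr
    _ < δ := hδ
    _ ≤ distInt (α * (x m - x n)) := by
        rw [mul_sub]
        exact hgap.trans (minGap_le_distInt (fun n => α * x n) hm hn hne)

theorem volume_largeGapSet_le_integral (x : ℕ → ℝ) {N : ℕ} {S : Finset (ℕ × ℕ)} {Z K δ τ : ℝ}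
    (hS : S ⊆ Finset.Icc 1 N ×ˢ Finset.Icc 1 N) (hne : S.Nonempty)
    (hz : ∀ p ∈ S, x p.1 - x p.2 ∈ Set.Ico Z (2 * Z)) (hZ : 0 < Z) (hK : 0 < K) (hτ : 0 < τ)
    (hτ₁ : τ ≤ 1) (hδ : 4 * K * Z * τ ≤ δ) :
    volume (largeGapSet x N K δ) ≤ ENNReal.ofReal (K ^ 2 / ((S.card : ℝ) ^ 2 * τ ^ 2 * Z) *
      ∫ y, ‖∑ p ∈ S, windowError τ (y - Real.log (x p.1 - x p.2))‖ ^ 2) := by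
  refine volume_le_of_floor_eq S (fun p => x p.1 - x p.2) hne hZ (fun p hp => (hz p hp).1) hK hτ
    (fun α hα => hα.1) fun α hα p hp => ?_
  obtain ⟨hp₁, hp₂⟩ := Finset.mem_product.1 (hS hp)
  refine floor_exp_mul_eq_of_mem_largeGapSet hp₁ hp₂ (hZ.trans_le (hz p hp).1) hK hτ.le hτ₁ ?_ hα
  calc 2 * τ * (K * (x p.1 - x p.2)) < 2 * τ * (K * (2 * Z)) := by
        gcongr
        exact (hz p hp).2
    _ = 4 * K * Z * τ := by ring
    _ ≤ δ := hδ

theorem LindelofHypothesis.volume_largeGapSet_le (hLH : LindelofHypothesis) {ε : ℝ} (hε : 0 < ε)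
    (hε₄ : ε ≤ 1 / 4) :
    ∃ C : ℝ, 0 < C ∧ ∀ (x : ℕ → ℝ) (N : ℕ) (S : Finset (ℕ × ℕ)) (Z K δ R : ℝ),
      S ⊆ Finset.Icc 1 N ×ˢ Finset.Icc 1 N → S.Nonempty →
      (∀ p ∈ S, x p.1 - x p.2 ∈ Set.Ico Z (2 * Z)) →
      0 < Z → 1 ≤ K → 1 ≤ K * Z → 0 < δ → δ ≤ 1 → 0 < R →
      volume (largeGapSet x N K δ) ≤ ENNReal.ofReal (C * K ^ 4 * R ^ (2 * ε) *
        (additiveEnergy x N / ((S.card : ℝ) ^ 2 * δ) + Real.exp (-(1 / δ)) / δ +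
          Z * R ^ (-(1 / 2) : ℝ) / δ ^ 2)) := by
  obtain ⟨C, hC, hmoment⟩ := hLH.integral_norm_sum_windowError_sq_le hε hε₄
  refine ⟨16 * C, by positivity, fun x N S Z K δ R hS hne hz hZ hK hKZ hδ hδ₁ hR => ?_⟩
  have hK₀ : 0 < K := by linarith
  have hcard : (0 : ℝ) < S.card := Nat.cast_pos.2 hne.card_pos
  obtain ⟨τ, rfl⟩ : ∃ τ, δ = 4 * K * Z * τ := ⟨δ / (4 * K * Z), by field_simp⟩
  have hτ : 0 < τ := pos_of_mul_pos_right hδ (by positivity)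
  have hτ₁ : τ ≤ 1 := by nlinarith
  have hw : 1 / (4 * K * Z * τ) * (2 * Z * τ) ≤ 1 := by
    rw [one_div_mul_eq_div, div_le_one hδ]
    gcongr
    linarith
  have hK₃ : 4 * K ^ 3 ≤ 16 * K ^ 4 := by
    linarith [pow_le_pow_right₀ hK (show 3 ≤ 4 by norm_num), pow_pos hK₀ 4]
  refine (volume_largeGapSet_le_integral x hS hne hz hZ hK₀ hτ hτ₁ le_rfl).trans
    (ENNReal.ofReal_le_ofReal ?_)
  generalize hw' : 1 / (4 * K * Z * τ) = w at hw ⊢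
  calc _ ≤ K ^ 2 / ((S.card : ℝ) ^ 2 * τ ^ 2 * Z) * (C * R ^ (2 * ε) *
          (τ * (additiveEnergy x N + (S.card : ℝ) ^ 2 * Real.exp (-w)) +
          (S.card : ℝ) ^ 2 * R ^ (-(1 / 2) : ℝ))) := by
        gcongr
        refine (hmoment S (fun p => Real.log (x p.1 - x p.2)) τ R hτ hτ₁ hR).trans ?_
        gcongr
        exact sum_exp_neg_abs_log_sub_le x hS hZ hτ hw hz
    _ = C * R ^ (2 * ε) * (4 * K ^ 3 *
          (additiveEnergy x N / ((S.card : ℝ) ^ 2 * (4 * K * Z * τ)) +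
            Real.exp (-w) / (4 * K * Z * τ)) +
          16 * K ^ 4 * (Z * R ^ (-(1 / 2) : ℝ) / (4 * K * Z * τ) ^ 2)) := by
        field_simp
        ring
    _ ≤ C * R ^ (2 * ε) * (16 * K ^ 4 *
          (additiveEnergy x N / ((S.card : ℝ) ^ 2 * (4 * K * Z * τ)) +
            Real.exp (-w) / (4 * K * Z * τ)) +
          16 * K ^ 4 * (Z * R ^ (-(1 / 2) : ℝ) / (4 * K * Z * τ) ^ 2)) := by gcongr
    _ = _ := by ring

end LargeGaps

section DyadicPigeonhole

variable {ι : Type*}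

/-- The pairs in `s × s` along which `f` descends, so that `f p.1 - f p.2` is positive. -/
noncomputable def descendingPairs (f : ι → ℝ) (s : Finset ι) : Finset (ι × ι) :=
  (s ×ˢ s).filter fun p => f p.2 < f p.1

theorem card_sq_le_four_mul_card_descendingPairs {f : ι → ℝ} {s : Finset ι}
    (hf : Set.InjOn f s) (hs : 2 ≤ s.card) : s.card ^ 2 ≤ 4 * (descendingPairs f s).card := by
  classical
  have hsub : s.offDiag ⊆ descendingPairs f s ∪ (descendingPairs f s).image Prod.swap := by
    rintro ⟨a, b⟩ hab
    obtain ⟨ha, hb, hne⟩ := Finset.mem_offDiag.1 hab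
    rcases lt_or_gt_of_ne (hf.ne ha hb hne) with h | h
    · exact Finset.mem_union_right _
        (Finset.mem_image.2 ⟨(b, a), by simp [descendingPairs, ha, hb, h], rfl⟩)
    · exact Finset.mem_union_left _ (by simp [descendingPairs, ha, hb, h])
  have hcard : s.card * s.card - s.card ≤ 2 * (descendingPairs f s).card := by
    rw [← Finset.offDiag_card, two_mul]
    exact (Finset.card_le_card hsub).trans ((Finset.card_union_le _ _).trans
      (Nat.add_le_add_left Finset.card_image_le _))
  have hmul : 2 * s.card ≤ s.card * s.card := Nat.mul_le_mul_right _ hs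
  rw [sq]
  omega

theorem mem_Ico_two_pow_floor_logb {c z : ℝ} (hc : 0 < c) (hz : c ≤ z) :
    z ∈ Set.Ico (c * 2 ^ ⌊Real.logb 2 (z / c)⌋₊) (2 * (c * 2 ^ ⌊Real.logb 2 (z / c)⌋₊)) := by
  have hpos : 0 < z / c := div_pos (hc.trans_le hz) hc
  have hlower := Nat.floor_le (Real.logb_nonneg one_lt_two ((one_le_div hc).2 hz))
  have hupper := Nat.lt_floor_add_one (Real.logb 2 (z / c))
  rw [Real.le_logb_iff_rpow_le one_lt_two hpos, Real.rpow_natCast, le_div_iff₀' hc] at hlower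
  rw [Real.logb_lt_iff_lt_rpow one_lt_two hpos, div_lt_iff₀' hc, Real.rpow_add two_pos,
    Real.rpow_one, Real.rpow_natCast] at hupper
  exact ⟨hlower, by linarith⟩

theorem exists_dyadic_subset {T : Finset ι} (hT : T.Nonempty) {z : ι → ℝ} {c U : ℝ} (hc : 0 < c)
    (hz : ∀ i ∈ T, z i ∈ Set.Icc c U) :
    ∃ Z, c ≤ Z ∧ ∃ S ⊆ T, (∀ i ∈ S, z i ∈ Set.Ico Z (2 * Z)) ∧
      (T.card : ℝ) ≤ (Real.logb 2 (U / c) + 1) * S.card := by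
  let L := ⌊Real.logb 2 (U / c)⌋₊
  have hcU : c ≤ U := hT.elim fun i hi => (hz i hi).1.trans (hz i hi).2
  have hmaps : ∀ i ∈ T, ⌊Real.logb 2 (z i / c)⌋₊ ∈ Finset.range (L + 1) := fun i hi => by
    rw [Finset.mem_range, Nat.lt_succ_iff]
    have := div_pos (hc.trans_le (hz i hi).1) hc
    refine Nat.floor_le_floor (Real.logb_le_logb_of_le one_lt_two this ?_)
    gcongr
    exact (hz i hi).2
  obtain ⟨j, -, hj⟩ := Finset.exists_le_card_fiber_of_nsmul_le_card_of_maps_to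
    (b := (T.card : ℝ) / (L + 1)) hmaps ⟨0, by simp⟩ <| by
      rw [Finset.card_range, nsmul_eq_mul, Nat.cast_succ, mul_div_cancel₀ _ (by positivity)]
  refine ⟨c * 2 ^ j, le_mul_of_one_le_right hc.le (one_le_pow₀ one_le_two),
    T.filter fun i => ⌊Real.logb 2 (z i / c)⌋₊ = j, Finset.filter_subset _ _, fun i hi => ?_, ?_⟩
  · obtain ⟨hiT, rfl⟩ := Finset.mem_filter.1 hi
    exact mem_Ico_two_pow_floor_logb hc (hz i hiT).1
  · rw [div_le_iff₀' (by positivity)] at hj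
    refine hj.trans ?_
    gcongr
    exact Nat.floor_le (Real.logb_nonneg one_lt_two ((one_le_div hc).2 hcU))

theorem exists_logb_two_mul_rpow_add_one_le {A D η : ℝ} (hA : 0 < A) (hD : 0 ≤ D) (hη : 0 < η) :
    ∃ M : ℝ, ∀ t : ℝ, 1 ≤ t → Real.logb 2 (A * t ^ D) + 1 ≤ M * t ^ η := by
  have hlog_two : 0 < Real.log 2 := Real.log_pos one_lt_two
  refine ⟨|Real.logb 2 A| + 1 + D / (η * Real.log 2), fun t ht => ?_⟩
  have ht₀ : 0 < t := by linarith
  have hpow : 1 ≤ t ^ η := Real.one_le_rpow ht hη.le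
  have hlog : Real.logb 2 t ≤ t ^ η / (η * Real.log 2) := by
    rw [Real.logb, ← div_div]
    gcongr
    exact Real.log_le_rpow_div ht₀.le hη
  calc Real.logb 2 (A * t ^ D) + 1 = (Real.logb 2 A + 1) * 1 + D * Real.logb 2 t := by
        rw [Real.logb_mul hA.ne' (by positivity), Real.logb_rpow_eq_mul_logb_of_pos ht₀]
        ring
    _ ≤ (|Real.logb 2 A| + 1) * t ^ η + D * (t ^ η / (η * Real.log 2)) := by
        gcongr
        exact le_abs_self _
    _ = _ := by ring

theorem exists_dyadic_descendingPairs {x : ℕ → ℝ} {c C D η : ℝ} (hc : 0 < c)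
    (hsep : (Set.Ici 1).Pairwise fun m n => c ≤ |x m - x n|) (hC : 0 < C) (hD : 0 ≤ D)
    (hgrowth : ∀ n : ℕ, 1 ≤ n → |x n| ≤ C * (n : ℝ) ^ D) (hη : 0 < η) :
    ∃ M : ℝ, ∀ N : ℕ, 2 ≤ N → ∃ (Z : ℝ) (S : Finset (ℕ × ℕ)), c ≤ Z ∧
      Z ≤ 2 * C * (N : ℝ) ^ D ∧ S ⊆ Finset.Icc 1 N ×ˢ Finset.Icc 1 N ∧ S.Nonempty ∧
      (∀ p ∈ S, x p.1 - x p.2 ∈ Set.Ico Z (2 * Z)) ∧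
      (N : ℝ) ^ 2 ≤ M * (N : ℝ) ^ η * S.card := by
  obtain ⟨M, hlog⟩ := exists_logb_two_mul_rpow_add_one_le (A := 2 * C / c) (by positivity) hD hη
  refine ⟨4 * M, fun N hN => ?_⟩
  have hN₁ : (1 : ℝ) ≤ N := by exact_mod_cast one_le_two.trans hN
  let T := descendingPairs x (Finset.Icc 1 N)
  have hinj : Set.InjOn x (Finset.Icc 1 N) := fun m hm n hn hmn => by
    by_contra hne
    have : c ≤ |x m - x n| := hsep (Finset.mem_Icc.1 hm).1 (Finset.mem_Icc.1 hn).1 hne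
    rw [hmn, sub_self, abs_zero] at this
    linarith
  have hcard : (N : ℝ) ^ 2 ≤ 4 * T.card := by
    have := card_sq_le_four_mul_card_descendingPairs hinj (by simpa using hN)
    rw [Nat.card_Icc, Nat.add_sub_cancel] at this
    exact_mod_cast this
  have hbound : ∀ n ∈ Finset.Icc 1 N, |x n| ≤ C * (N : ℝ) ^ D := fun n hn => by
    obtain ⟨hn₁, hnN⟩ := Finset.mem_Icc.1 hn
    refine (hgrowth n hn₁).trans ?_
    gcongr
  have hz : ∀ p ∈ T, x p.1 - x p.2 ∈ Set.Icc c (2 * C * (N : ℝ) ^ D) := fun p hp => by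
    obtain ⟨hmem, hlt⟩ := Finset.mem_filter.1 hp
    obtain ⟨hp₁, hp₂⟩ := Finset.mem_product.1 hmem
    refine ⟨?_, by linarith [abs_le.1 (hbound _ hp₁), abs_le.1 (hbound _ hp₂)]⟩
    rw [← abs_of_pos (sub_pos.2 hlt)]
    exact hsep (Finset.mem_Icc.1 hp₁).1 (Finset.mem_Icc.1 hp₂).1 fun h => hlt.ne' (by rw [h])
  have hT : T.Nonempty := Finset.card_pos.1 (Nat.cast_pos.1 (by nlinarith : (0 : ℝ) < T.card))
  obtain ⟨Z, hcZ, S, hST, hZ, hTS⟩ := exists_dyadic_subset hT hc hz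
  have hcardS : (N : ℝ) ^ 2 ≤ 4 * M * (N : ℝ) ^ η * S.card := by
    rw [mul_div_right_comm] at hTS
    calc (N : ℝ) ^ 2 ≤ 4 * ((Real.logb 2 (2 * C / c * (N : ℝ) ^ D) + 1) * S.card) := by linarith
      _ ≤ 4 * (M * (N : ℝ) ^ η * S.card) := by
          gcongr
          exact hlog N hN₁
      _ = _ := by ring
  have hS : S.Nonempty := by
    by_contra h
    rw [Finset.not_nonempty_iff_eq_empty.1 h, Finset.card_empty, Nat.cast_zero, mul_zero] at hcardS
    nlinarith
  obtain ⟨p, hp⟩ := hS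
  exact ⟨Z, S, hcZ, (hZ p hp).1.trans (hz p (hST hp)).2,
    fun q hq => (Finset.mem_filter.1 (hST hq)).1, ⟨p, hp⟩, hZ, hcardS⟩

end DyadicPigeonhole

section MeasureDecay

theorem exists_abs_le_mul_natCast_rpow {f : ℕ → ℝ} {a : ℝ}
    (h : f =O[atTop] fun n : ℕ => (n : ℝ) ^ a) :
    ∃ C : ℝ, 0 < C ∧ ∀ n : ℕ, 1 ≤ n → |f n| ≤ C * (n : ℝ) ^ a := by
  obtain ⟨C, hC, hbound⟩ := bound_of_isBigO_nat_atTop h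
  refine ⟨C, hC, fun n hn => ?_⟩
  have hpos : 0 < (n : ℝ) ^ a := Real.rpow_pos_of_pos (Nat.cast_pos.2 hn) a
  simpa only [Real.norm_eq_abs, abs_of_pos hpos] using hbound hpos.ne'

theorem exists_abs_le_mul_natCast_rpow_nonneg {x : ℕ → ℝ}
    (h : ∃ C : ℝ, x =O[atTop] fun n : ℕ => (n : ℝ) ^ C) :
    ∃ C D : ℝ, 0 < C ∧ 0 ≤ D ∧ ∀ n : ℕ, 1 ≤ n → |x n| ≤ C * (n : ℝ) ^ D := by
  obtain ⟨D, hD⟩ := h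
  obtain ⟨C, hC, hbound⟩ := exists_abs_le_mul_natCast_rpow hD
  refine ⟨C, max D 0, hC, le_max_right _ _, fun n hn => (hbound n hn).trans ?_⟩
  have hn₁ : (1 : ℝ) ≤ n := Nat.one_le_cast.2 hn
  gcongr
  exact le_max_left _ _

theorem exists_mul_exp_neg_le (a : ℝ) :
    ∃ C : ℝ, ∀ w : ℝ, 1 ≤ w → w * Real.exp (-w) ≤ C * w ^ (-a) := by
  obtain ⟨k, hk⟩ := exists_nat_ge (a + 1)
  refine ⟨k.factorial, fun w hw => ?_⟩
  have hw₀ : 0 < w := by linarith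
  have hexp := Real.pow_div_factorial_le_exp w hw₀.le k
  rw [div_le_iff₀' (by positivity)] at hexp
  rw [Real.rpow_neg hw₀.le, Real.exp_neg, ← div_eq_mul_inv, ← div_eq_mul_inv,
    div_le_div_iff₀ (Real.exp_pos _) (by positivity)]
  calc w * w ^ a = w ^ (a + 1) := by rw [Real.rpow_add_one hw₀.ne', mul_comm]
    _ ≤ w ^ (k : ℝ) := by gcongr
    _ = w ^ k := Real.rpow_natCast w k
    _ ≤ k.factorial * Real.exp w := hexp

variable {t κ a : ℝ}

theorem exists_exp_neg_div_rpow_neg_le (hκ : 0 < κ) (a : ℝ) :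
    ∃ C : ℝ, ∀ t : ℝ, 1 ≤ t →
      Real.exp (-(1 / t ^ (-κ))) / t ^ (-κ) ≤ C * t ^ (-a) := by
  obtain ⟨C, h⟩ := exists_mul_exp_neg_le (a / κ)
  refine ⟨C, fun t ht => ?_⟩
  have ht₀ : 0 ≤ t := by linarith
  have := h (t ^ κ) (Real.one_le_rpow ht hκ.le)
  rwa [← Real.rpow_mul ht₀, mul_neg, mul_div_cancel₀ a hκ.ne', ← one_div_one_div (t ^ κ),
    one_div_mul_eq_div, one_div (t ^ κ), ← Real.rpow_neg ht₀] at this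

theorem mul_rpow_neg_half_div_sq_le {Z C D : ℝ} (ht : 0 < t) (hZ : Z ≤ C * t ^ D) :
    Z * (t ^ (2 * (D + 2 * κ + a))) ^ (-(1 / 2) : ℝ) / (t ^ (-κ)) ^ 2 ≤ C * t ^ (-a) := by
  have hpow : (t ^ (2 * (D + 2 * κ + a))) ^ (-(1 / 2) : ℝ) = t ^ (-a) * (t ^ (-κ)) ^ 2 / t ^ D := by
    rw [← Real.rpow_mul ht.le, ← Real.rpow_mul_natCast ht.le, ← Real.rpow_add ht,
      ← Real.rpow_sub ht]
    congr 1
    push_cast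
    ring
  rw [hpow, div_le_iff₀ (by positivity)]
  calc Z * (t ^ (-a) * (t ^ (-κ)) ^ 2 / t ^ D)
      ≤ C * t ^ D * (t ^ (-a) * (t ^ (-κ)) ^ 2 / t ^ D) := by gcongr
    _ = C * t ^ (-a) * (t ^ (-κ)) ^ 2 := by field_simp

theorem rpow_rpow_two_mul_min_le {m ε : ℝ} (ht : 1 ≤ t) (hm : 0 < m) :
    (t ^ m) ^ (2 * min (1 / 4) (ε / (8 * m))) ≤ t ^ (ε / 4) := by
  rw [← Real.rpow_mul (by linarith)]
  gcongr
  calc m * (2 * min (1 / 4) (ε / (8 * m))) ≤ m * (2 * (ε / (8 * m))) := by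
        gcongr
        exact min_le_right _ _
    _ = ε / 4 := by
        field_simp
        ring

theorem div_sq_mul_rpow_neg_le {A E M C β ε : ℝ} (ht : 0 < t) (hA : 0 < A) (hC : 0 ≤ C)
    (hE : E ≤ C * t ^ (β + ε / 4)) (hM : t ^ 2 ≤ M * t ^ (ε / 8) * A) :
    E / (A ^ 2 * t ^ (-(4 - β - ε))) ≤ C * M ^ 2 * t ^ (-(ε / 2)) := by
  have hpow : t ^ (β + ε / 4) * (t ^ (ε / 8)) ^ 2 =
      t ^ (-(ε / 2)) * t ^ (-(4 - β - ε)) * (t ^ 2) ^ 2 := by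
    rw [← pow_mul, ← Real.rpow_natCast t, ← Real.rpow_mul_natCast ht.le, ← Real.rpow_add ht,
      ← Real.rpow_add ht, ← Real.rpow_add ht]
    congr 1
    push_cast
    ring
  rw [div_le_iff₀ (by positivity), ← mul_le_mul_iff_left₀ (by positivity : 0 < (t ^ (ε / 8)) ^ 2)]
  calc E * (t ^ (ε / 8)) ^ 2 ≤ C * t ^ (β + ε / 4) * (t ^ (ε / 8)) ^ 2 := by gcongr
    _ = C * t ^ (-(ε / 2)) * t ^ (-(4 - β - ε)) * (t ^ 2) ^ 2 := by
        rw [mul_assoc, hpow]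
        ring
    _ ≤ C * t ^ (-(ε / 2)) * t ^ (-(4 - β - ε)) * (M * t ^ (ε / 8) * A) ^ 2 := by gcongr
    _ = _ := by ring

theorem LindelofHypothesis.volume_largeGapSet_rpow_le (hLH : LindelofHypothesis) {x : ℕ → ℝ}
    {c : ℝ} (hc : 0 < c) (hsep : (Set.Ici 1).Pairwise fun m n => c ≤ |x m - x n|)
    (hgrowth : ∃ C : ℝ, x =O[atTop] fun n : ℕ => (n : ℝ) ^ C) {K : ℝ} (hK : 1 ≤ K)
    (hKc : 1 ≤ K * c) {β : ℝ} (hβ : EnergyBound x β) {ε : ℝ} (hε : 0 < ε) (hκ : 0 < 4 - β - ε) :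
    ∃ M : ℝ, ∀ N : ℕ, 2 ≤ N → volume (largeGapSet x N K ((N : ℝ) ^ (-(4 - β - ε)))) ≤
      ENNReal.ofReal (M * (N : ℝ) ^ (-(ε / 4))) := by
  obtain ⟨CX, D, hCX, hD, hX⟩ := exists_abs_le_mul_natCast_rpow_nonneg hgrowth
  obtain ⟨CE, hCE, hE⟩ := exists_abs_le_mul_natCast_rpow (hβ (ε / 4) (by positivity))
  obtain ⟨M, hdyadic⟩ := exists_dyadic_descendingPairs hc hsep hCX hD hX
    (η := ε / 8) (by positivity)
  obtain ⟨CT, hT⟩ := exists_exp_neg_div_rpow_neg_le hκ (ε / 2)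
  -- With `R = N ^ m` the term of size `R ^ (-1/2)` becomes negligible.
  let m := 2 * (D + 2 * (4 - β - ε) + ε / 2)
  have hm : 0 < m := by positivity
  obtain ⟨CV, hCV, hV⟩ := hLH.volume_largeGapSet_le (ε := min (1 / 4) (ε / (8 * m)))
    (by positivity) (min_le_left _ _)
  refine ⟨CV * K ^ 4 * (CE * M ^ 2 + CT + 2 * CX), fun N hN => ?_⟩
  obtain ⟨Z, S, hcZ, hZ, hS, hS_ne, hSZ, hcard⟩ := hdyadic N hN
  have hN₁ : (1 : ℝ) ≤ N := by exact_mod_cast one_le_two.trans hN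
  have hN₀ : (0 : ℝ) < N := by linarith
  have hZ₀ : 0 < Z := hc.trans_le hcZ
  refine (hV x N S Z K _ (N ^ m) hS hS_ne hSZ hZ₀ hK (hKc.trans (by gcongr)) (by positivity)
    (Real.rpow_le_one_of_one_le_of_nonpos hN₁ (by linarith)) (by positivity)).trans
    (ENNReal.ofReal_le_ofReal ?_)
  calc _ ≤ CV * K ^ 4 * (N : ℝ) ^ (ε / 4) * (CE * M ^ 2 * (N : ℝ) ^ (-(ε / 2)) +
        CT * (N : ℝ) ^ (-(ε / 2)) + 2 * CX * (N : ℝ) ^ (-(ε / 2))) := by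
        gcongr
        · exact rpow_rpow_two_mul_min_le hN₁ hm
        · exact div_sq_mul_rpow_neg_le hN₀ (Nat.cast_pos.2 hS_ne.card_pos) hCE.le
            ((le_abs_self _).trans (hE N (by omega))) hcard
        · exact hT N hN₁
        · exact mul_rpow_neg_half_div_sq_le hN₀ hZ
    _ = CV * K ^ 4 * (CE * M ^ 2 + CT + 2 * CX) * ((N : ℝ) ^ (ε / 4) * (N : ℝ) ^ (-(ε / 2))) := by
        ring
    _ = _ := by
        rw [← Real.rpow_add hN₀]
        ring_nf

end MeasureDecay

section BorelCantelli

theorem minGap_antitoneOn (y : ℕ → ℝ) : AntitoneOn (minGap y) (Set.Ici 2) := by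
  intro M hM N _ hMN
  obtain ⟨m, hm, n, hn, hmn, h⟩ := (isLeast_minGap y hM).1
  rw [h]
  exact minGap_le_distInt y (Finset.Icc_subset_Icc_right hMN hm)
    (Finset.Icc_subset_Icc_right hMN hn) hmn

theorem ae_eventually_notMem_two_pow {Ω : Type*} [MeasurableSpace Ω] {μ : Measure Ω}
    {s : ℕ → Set Ω} {M θ : ℝ} (hθ : 0 < θ)
    (h : ∀ N : ℕ, 2 ≤ N → μ (s N) ≤ ENNReal.ofReal (M * (N : ℝ) ^ (-θ))) :
    ∀ᵐ α ∂μ, ∀ᶠ j : ℕ in atTop, α ∉ s (2 ^ j) := by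
  have hratio : (2 : ℝ) ^ (-θ) < 1 :=
    Real.rpow_lt_one_of_one_lt_of_neg one_lt_two (neg_lt_zero.2 hθ)
  have hsum : Summable fun j : ℕ => M * ((2 : ℝ) ^ (-θ)) ^ (j + 1) :=
    ((summable_nat_add_iff 1).2 (summable_geometric_of_lt_one (by positivity) hratio)).mul_left M
  have hfin : ∑' j : ℕ, μ (s (2 ^ (j + 1))) ≠ ⊤ := by
    refine ne_top_of_le_ne_top hsum.tsum_ofReal_ne_top (ENNReal.tsum_le_tsum fun j => ?_)
    refine (h _ (Nat.le_self_pow j.succ_ne_zero 2)).trans_eq ?_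
    rw [Nat.cast_pow, Nat.cast_ofNat, Real.rpow_pow_comm two_pos.le]
  filter_upwards [ae_eventually_notMem hfin] with α hα
  rw [← map_add_atTop_eq_nat 1]
  exact hα

theorem eventually_mul_rpow_le (A : ℝ) {a b : ℝ} (hab : a < b) :
    ∀ᶠ N : ℕ in atTop, A * (N : ℝ) ^ a ≤ (N : ℝ) ^ b := by
  have hbig : ∀ᶠ N : ℕ in atTop, A ≤ (N : ℝ) ^ (b - a) :=
    ((tendsto_rpow_atTop (sub_pos.2 hab)).comp tendsto_natCast_atTop_atTop).eventually_ge_atTop A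
  filter_upwards [hbig, eventually_ge_atTop 1] with N hA hN
  have hN₀ : (0 : ℝ) < N := Nat.cast_pos.2 hN
  calc A * (N : ℝ) ^ a ≤ (N : ℝ) ^ (b - a) * (N : ℝ) ^ a := by gcongr
    _ = (N : ℝ) ^ b := by rw [← Real.rpow_add hN₀, sub_add_cancel]

theorem tendsto_nat_log_atTop {b : ℕ} (hb : 1 < b) : Tendsto (Nat.log b) atTop atTop :=
  tendsto_atTop.2 fun k => (eventually_ge_atTop (b ^ k)).mono fun _ hN =>
    Nat.le_log_of_pow_le hb hN

variable {f : ℕ → ℝ} {κ κ' : ℝ}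

theorem eventually_lt_rpow_of_two_pow (hf : AntitoneOn f (Set.Ici 2)) (hκ : 0 ≤ κ) (hκ' : κ' < κ)
    (h : ∀ᶠ j : ℕ in atTop, f (2 ^ j) < ((2 ^ j : ℕ) : ℝ) ^ (-κ)) :
    ∀ᶠ N : ℕ in atTop, f N < (N : ℝ) ^ (-κ') := by
  filter_upwards [(tendsto_nat_log_atTop one_lt_two).eventually h, eventually_ge_atTop 2,
    eventually_mul_rpow_le (2 ^ κ) (neg_lt_neg hκ')] with N hpow hN hconst
  have hle : 2 ^ Nat.log 2 N ≤ N := Nat.pow_log_le_self 2 (by omega)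
  have htwo : 2 ≤ 2 ^ Nat.log 2 N := Nat.le_self_pow (Nat.log_pos one_lt_two hN).ne' 2
  have hhalf : (N : ℝ) / 2 ≤ (2 ^ Nat.log 2 N : ℕ) := by
    rw [div_le_iff₀ two_pos]
    exact_mod_cast pow_succ 2 (Nat.log 2 N) ▸ (Nat.lt_pow_succ_log_self one_lt_two N).le
  calc f N ≤ f (2 ^ Nat.log 2 N) := hf htwo hN hle
    _ < ((2 ^ Nat.log 2 N : ℕ) : ℝ) ^ (-κ) := hpow
    _ ≤ ((N : ℝ) / 2) ^ (-κ) :=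
        Real.rpow_le_rpow_of_nonpos (by positivity) hhalf (neg_nonpos.2 hκ)
    _ = 2 ^ κ * (N : ℝ) ^ (-κ) := by
        rw [Real.div_rpow N.cast_nonneg two_pos.le, Real.rpow_neg two_pos.le κ, div_inv_eq_mul,
          mul_comm]
    _ ≤ (N : ℝ) ^ (-κ') := hconst

theorem eventually_rpow_le_of_two_pow (hf : AntitoneOn f (Set.Ici 2)) (hκ : 0 ≤ κ) (hκ' : κ < κ')
    (h : ∀ᶠ j : ℕ in atTop, ((2 ^ j : ℕ) : ℝ) ^ (-κ) ≤ f (2 ^ j)) :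
    ∀ᶠ N : ℕ in atTop, (N : ℝ) ^ (-κ') ≤ f N := by
  have hlog : Tendsto (fun N => Nat.log 2 N + 1) atTop atTop :=
    (tendsto_add_atTop_nat 1).comp (tendsto_nat_log_atTop one_lt_two)
  filter_upwards [hlog.eventually h, eventually_ge_atTop 2,
    eventually_mul_rpow_le (2 ^ κ) (neg_lt_neg hκ')] with N hpow hN hconst
  have hle : N ≤ 2 ^ (Nat.log 2 N + 1) := (Nat.lt_pow_succ_log_self one_lt_two N).le
  have hdouble : ((2 ^ (Nat.log 2 N + 1) : ℕ) : ℝ) ≤ 2 * N := by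
    have := Nat.pow_log_le_self 2 (by omega : N ≠ 0)
    exact_mod_cast (by rw [pow_succ]; omega : 2 ^ (Nat.log 2 N + 1) ≤ 2 * N)
  calc (N : ℝ) ^ (-κ') ≤ (2 * N : ℝ) ^ (-κ) := by
        rw [Real.mul_rpow two_pos.le N.cast_nonneg, Real.rpow_neg two_pos.le, ← div_eq_inv_mul,
          le_div_iff₀' (by positivity)]
        exact hconst
    _ ≤ ((2 ^ (Nat.log 2 N + 1) : ℕ) : ℝ) ^ (-κ) :=
        Real.rpow_le_rpow_of_nonpos (by positivity) hdouble (neg_nonpos.2 hκ)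
    _ ≤ f (2 ^ (Nat.log 2 N + 1)) := hpow
    _ ≤ f N := hf hN (hN.trans hle) hle

end BorelCantelli

section SmallGaps

theorem setOf_distInt_mul_lt_subset {K δ z : ℝ} (hz : z ≠ 0) :
    {α : ℝ | |α| ≤ K ∧ distInt (α * z) < δ} ⊆
      ⋃ k ∈ Finset.Icc (-(⌊K * |z| + 1 / 2⌋₊ : ℤ)) ⌊K * |z| + 1 / 2⌋₊,
        Metric.ball ((k : ℝ) / z) (δ / |z|) := by
  rintro α ⟨hα, hlt⟩
  have hround : (((round (α * z)).natAbs : ℕ) : ℝ) ≤ K * |z| + 1 / 2 := by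
    rw [Nat.cast_natAbs, Int.cast_abs]
    calc |(round (α * z) : ℝ)| ≤ |α * z| + |α * z - round (α * z)| := by
          have := abs_sub_abs_le_abs_sub (round (α * z) : ℝ) (α * z)
          rw [abs_sub_comm] at this
          linarith
      _ ≤ K * |z| + 1 / 2 := by
          rw [abs_mul]
          gcongr
          exact abs_sub_round _
  have hfloor := Nat.le_floor hround
  refine Set.mem_iUnion₂.2 ⟨round (α * z), Finset.mem_Icc.2 ⟨by omega, by omega⟩, ?_⟩
  rw [Metric.mem_ball, Real.dist_eq, lt_div_iff₀ (abs_pos.2 hz), ← abs_mul, sub_mul,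
    div_mul_cancel₀ _ hz]
  exact hlt

theorem volume_distInt_mul_lt_le {K c δ z : ℝ} (hK : 0 ≤ K) (hc : 0 < c) (hδ : 0 ≤ δ)
    (hz : c ≤ |z|) :
    volume {α : ℝ | |α| ≤ K ∧ distInt (α * z) < δ} ≤ ENNReal.ofReal ((4 * K + 4 / c) * δ) := by
  have hz₀ : 0 < |z| := hc.trans_le hz
  refine (measure_mono (setOf_distInt_mul_lt_subset (abs_pos.1 hz₀))).trans
    ((measure_biUnion_finset_le _ _).trans ?_)
  simp only [Real.volume_ball, Finset.sum_const, Int.card_Icc]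
  rw [← ENNReal.ofReal_nsmul]
  refine ENNReal.ofReal_le_ofReal ?_
  rw [nsmul_eq_mul]
  set J := ⌊K * |z| + 1 / 2⌋₊
  have hcard : ((J : ℤ) + 1 - -(J : ℤ)).toNat = 2 * J + 1 := by omega
  rw [hcard, Nat.cast_succ, Nat.cast_mul, Nat.cast_ofNat]
  calc (2 * (J : ℝ) + 1) * (2 * (δ / |z|)) ≤ (2 * (K * |z| + 1 / 2) + 1) * (2 * (δ / |z|)) := by
        gcongr
        exact Nat.floor_le (by positivity)
    _ = (4 * K + 4 / |z|) * δ := by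
        field_simp
        ring
    _ ≤ (4 * K + 4 / c) * δ := by gcongr

/-- The set of `α` with `|α| ≤ K` for which the minimal gap of the first `N` terms of `α x` is
less than `δ`. -/
def smallGapSet (x : ℕ → ℝ) (N : ℕ) (K δ : ℝ) : Set ℝ :=
  {α | |α| ≤ K ∧ minGap (fun n => α * x n) N < δ}

theorem smallGapSet_subset (x : ℕ → ℝ) {N : ℕ} (hN : 2 ≤ N) (K δ : ℝ) :
    smallGapSet x N K δ ⊆ ⋃ p ∈ (Finset.Icc 1 N).offDiag,
      {α | |α| ≤ K ∧ distInt (α * (x p.1 - x p.2)) < δ} := by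
  rintro α ⟨hα, hlt⟩
  obtain ⟨m, hm, n, hn, hmn, h⟩ := (isLeast_minGap (fun n => α * x n) hN).1
  refine Set.mem_iUnion₂.2 ⟨(m, n), Finset.mem_offDiag.2 ⟨hm, hn, hmn⟩, hα, ?_⟩
  rw [mul_sub]
  exact h ▸ hlt

theorem volume_smallGapSet_le {x : ℕ → ℝ} {c K δ : ℝ} (hc : 0 < c)
    (hsep : (Set.Ici 1).Pairwise fun m n => c ≤ |x m - x n|) (hK : 0 ≤ K) (hδ : 0 ≤ δ)
    {N : ℕ} (hN : 2 ≤ N) :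
    volume (smallGapSet x N K δ) ≤ ENNReal.ofReal ((4 * K + 4 / c) * ((N : ℝ) ^ 2 * δ)) := by
  have hcard : ((Finset.Icc 1 N).offDiag.card : ℝ) ≤ (N : ℝ) ^ 2 := by
    rw [Finset.offDiag_card, Nat.card_Icc, Nat.add_sub_cancel, ← sq]
    exact_mod_cast Nat.sub_le _ _
  calc volume (smallGapSet x N K δ)
      ≤ ∑ p ∈ (Finset.Icc 1 N).offDiag,
          volume {α : ℝ | |α| ≤ K ∧ distInt (α * (x p.1 - x p.2)) < δ} :=
        (measure_mono (smallGapSet_subset x hN K δ)).trans (measure_biUnion_finset_le _ _)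
    _ ≤ (Finset.Icc 1 N).offDiag.card • ENNReal.ofReal ((4 * K + 4 / c) * δ) := by
        refine Finset.sum_le_card_nsmul _ _ _ fun p hp => ?_
        obtain ⟨hp₁, hp₂, hne⟩ := Finset.mem_offDiag.1 hp
        exact volume_distInt_mul_lt_le hK hc hδ
          (hsep (Finset.mem_Icc.1 hp₁).1 (Finset.mem_Icc.1 hp₂).1 hne)
    _ ≤ ENNReal.ofReal ((4 * K + 4 / c) * ((N : ℝ) ^ 2 * δ)) := by
        rw [← ENNReal.ofReal_nsmul, nsmul_eq_mul, mul_left_comm]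
        gcongr

theorem ae_eventually_rpow_le_minGap {x : ℕ → ℝ} {c : ℝ} (hc : 0 < c)
    (hsep : (Set.Ici 1).Pairwise fun m n => c ≤ |x m - x n|) {ε : ℝ} (hε : 0 < ε) :
    ∀ᵐ α : ℝ, ∀ᶠ N : ℕ in atTop, (N : ℝ) ^ (-(2 + ε)) ≤ minGap (fun n => α * x n) N := by
  have hsmall (K : ℕ) : ∀ᵐ α : ℝ, ∀ᶠ j : ℕ in atTop,
      α ∉ smallGapSet x (2 ^ j) K (((2 ^ j : ℕ) : ℝ) ^ (-(2 + ε / 2))) := by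
    refine ae_eventually_notMem_two_pow (s := fun N => smallGapSet x N K (N ^ (-(2 + ε / 2))))
      (M := 4 * K + 4 / c) (half_pos hε) fun N hN => ?_
    have hN₀ : (0 : ℝ) < N := Nat.cast_pos.2 (by omega)
    refine (volume_smallGapSet_le hc hsep K.cast_nonneg (by positivity) hN).trans_eq ?_
    rw [← Real.rpow_natCast, ← Real.rpow_add hN₀]
    congr 3
    push_cast
    ring
  filter_upwards [ae_all_iff.2 hsmall] with α hα
  obtain ⟨K, hK⟩ := exists_nat_ge |α|
  refine eventually_rpow_le_of_two_pow (minGap_antitoneOn _) (κ := 2 + ε / 2) (by positivity)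
    (by linarith) ((hα K).mono fun j hj => ?_)
  exact not_lt.1 fun hlt => hj ⟨hK, hlt⟩

end SmallGaps

section LargeGapsAlmostEverywhere

theorem distInt_neg (u : ℝ) : distInt (-u) = distInt u := by
  rw [distInt, distInt, ← UnitAddCircle.norm_eq, ← UnitAddCircle.norm_eq, AddCircle.coe_neg,
    norm_neg]

theorem minGap_neg (y : ℕ → ℝ) (N : ℕ) : minGap (fun n => -y n) N = minGap y N := by
  have hdist (m n : ℕ) : distInt (-y m - -y n) = distInt (y m - y n) := by
    rw [← distInt_neg, neg_sub_neg, neg_sub]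
  simp only [minGap, gapSet, hdist]

theorem minGap_mem_Icc (y : ℕ → ℝ) {N : ℕ} (hN : 2 ≤ N) : minGap y N ∈ Set.Icc 0 (1 / 2) := by
  obtain ⟨m, -, n, -, -, h⟩ := (isLeast_minGap y hN).1
  rw [h]
  exact ⟨abs_nonneg _, abs_sub_round _⟩

theorem ae_pos_of_eventually_ae_Icc {P : ℝ → Prop}
    (h : ∀ᶠ K : ℕ in atTop, ∀ᵐ α : ℝ, α ∈ Set.Icc (K : ℝ)⁻¹ K → P α) :
    ∀ᵐ α : ℝ, 0 < α → P α := by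
  obtain ⟨K₀, hK₀⟩ := eventually_atTop.1 h
  filter_upwards [ae_all_iff.2 fun K => hK₀ (K₀ + K) (Nat.le_add_right _ _)] with α hα hα₀
  obtain ⟨K, hK⟩ := exists_nat_ge (max α α⁻¹)
  have hle : (K : ℝ) ≤ (K₀ + K : ℕ) := Nat.cast_le.2 (Nat.le_add_left _ _)
  exact hα K ⟨inv_le_of_inv_le₀ hα₀ ((le_max_right _ _).trans (hK.trans hle)),
    (le_max_left _ _).trans (hK.trans hle)⟩

theorem ae_of_eventually_ae_Icc {P : ℝ → Prop} (hneg : ∀ α, P (-α) → P α)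
    (h : ∀ᶠ K : ℕ in atTop, ∀ᵐ α : ℝ, α ∈ Set.Icc (K : ℝ)⁻¹ K → P α) : ∀ᵐ α : ℝ, P α := by
  have hpos := ae_pos_of_eventually_ae_Icc h
  have hpos_neg : ∀ᵐ α : ℝ, 0 < -α → P (-α) :=
    (Measure.measurePreserving_neg volume).quasiMeasurePreserving.ae hpos
  filter_upwards [hpos, hpos_neg, Measure.ae_ne volume 0] with α hα hα_neg hne
  rcases hne.lt_or_gt with h | h
  · exact hneg α (hα_neg (neg_pos.2 h))
  · exact hα h

theorem LindelofHypothesis.ae_eventually_minGap_lt_rpow (hLH : LindelofHypothesis) {x : ℕ → ℝ}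
    {c : ℝ} (hc : 0 < c) (hsep : (Set.Ici 1).Pairwise fun m n => c ≤ |x m - x n|)
    (hgrowth : ∃ C : ℝ, x =O[atTop] fun n : ℕ => (n : ℝ) ^ C) {β : ℝ} (hβ : EnergyBound x β)
    {ε : ℝ} (hε : 0 < ε) :
    ∀ᵐ α : ℝ, ∀ᶠ N : ℕ in atTop, minGap (fun n => α * x n) N < (N : ℝ) ^ (-(4 - β - ε)) := by
  rcases le_or_gt (4 - β - ε) 0 with hκ | hκ
  · refine Eventually.of_forall fun α => (eventually_ge_atTop 2).mono fun N hN => ?_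
    calc minGap (fun n => α * x n) N ≤ 1 / 2 := (minGap_mem_Icc _ hN).2
      _ < 1 := one_half_lt_one
      _ ≤ (N : ℝ) ^ (-(4 - β - ε)) :=
          Real.one_le_rpow (by exact_mod_cast one_le_two.trans hN) (neg_nonneg.2 hκ)
  refine ae_of_eventually_ae_Icc (fun α h => ?_) ?_
  · simpa only [neg_mul, minGap_neg] using h
  filter_upwards [tendsto_natCast_atTop_atTop.eventually_ge_atTop (max 1 c⁻¹)] with K hK
  have hKc : 1 ≤ (K : ℝ) * c := (inv_le_iff_one_le_mul₀ hc).1 ((le_max_right _ _).trans hK)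
  obtain ⟨M, hM⟩ := hLH.volume_largeGapSet_rpow_le hc hsep hgrowth ((le_max_left _ _).trans hK)
    hKc hβ (half_pos hε) (by linarith)
  have hlarge := ae_eventually_notMem_two_pow
    (s := fun N => largeGapSet x N K (N ^ (-(4 - β - ε / 2)))) (by positivity) hM
  filter_upwards [hlarge] with α hα hαK
  refine eventually_lt_rpow_of_two_pow (minGap_antitoneOn _) (κ := 4 - β - ε / 2) (by linarith)
    (by linarith) (hα.mono fun j hj => ?_)
  exact not_le.1 fun hle => hj ⟨hαK, hle⟩

end LargeGapsAlmostEverywhere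

section VanishingExponent

theorem ae_forall_pos {Ω : Type*} [MeasurableSpace Ω] {μ : Measure Ω} {P : ℝ → Ω → Prop}
    (hmono : ∀ ω, Monotone fun ε => P ε ω) (h : ∀ ε, 0 < ε → ∀ᵐ ω ∂μ, P ε ω) :
    ∀ᵐ ω ∂μ, ∀ ε, 0 < ε → P ε ω := by
  filter_upwards [ae_all_iff.2 fun n : ℕ => h (1 / (n + 1)) Nat.one_div_pos_of_nat] with ω hω ε hε
  obtain ⟨n, hn⟩ := exists_nat_one_div_lt hε
  exact hmono ω hn.le (hω n)

theorem eventually_rpow_le_rpow {a b : ℝ} (hab : a ≤ b) :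
    ∀ᶠ N : ℕ in atTop, (N : ℝ) ^ a ≤ (N : ℝ) ^ b :=
  (eventually_ge_atTop 1).mono fun _ hN =>
    Real.rpow_le_rpow_of_exponent_le (Nat.one_le_cast.2 hN) hab

variable {f : ℕ → ℝ} {κ : ℝ}

theorem pos_of_antitoneOn_of_eventually_rpow_le (hf : AntitoneOn f (Set.Ici 2))
    (h : ∀ᶠ N : ℕ in atTop, (N : ℝ) ^ κ ≤ f N) {N : ℕ} (hN : 2 ≤ N) : 0 < f N := by
  obtain ⟨M, hM, hNM⟩ := (h.and (eventually_ge_atTop N)).exists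
  have hM₀ : (0 : ℝ) < M := Nat.cast_pos.2 (by omega)
  exact ((Real.rpow_pos_of_pos hM₀ κ).trans_le hM).trans_le (hf hN (hN.trans hNM) hNM)

theorem exists_tendsto_zero_eq_one_div_rpow (hf : ∀ N, 2 ≤ N → 0 < f N)
    (hupper : ∀ ε, 0 < ε → ∀ᶠ N : ℕ in atTop, f N < (N : ℝ) ^ (-(κ - ε)))
    (hlower : ∀ ε, 0 < ε → ∀ᶠ N : ℕ in atTop, (N : ℝ) ^ (-(κ + ε)) ≤ f N) :
    ∃ η : ℕ → ℝ, Tendsto η atTop (𝓝 0) ∧ ∀ N : ℕ, 2 ≤ N → f N = 1 / (N : ℝ) ^ (κ + η N) := by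
  have hone {N : ℕ} (hN : 2 ≤ N) : (1 : ℝ) < N := Nat.one_lt_cast.2 hN
  refine ⟨fun N => -κ - Real.logb N (f N), ?_, fun N hN => ?_⟩
  · refine Metric.tendsto_nhds.2 fun ε hε => ?_
    filter_upwards [hupper (ε / 2) (half_pos hε), hlower (ε / 2) (half_pos hε),
      eventually_ge_atTop 2] with N hlt hle hN
    rw [← Real.logb_lt_iff_lt_rpow (hone hN) (hf N hN)] at hlt
    rw [← Real.le_logb_iff_rpow_le (hone hN) (hf N hN)] at hle
    rw [Real.dist_eq, sub_zero, abs_lt]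
    constructor <;> linarith
  · have hexponent : -(κ + (-κ - Real.logb N (f N))) = Real.logb N (f N) := by ring
    rw [one_div, ← Real.rpow_neg N.cast_nonneg, hexponent,
      Real.rpow_logb (by linarith [hone hN]) (hone hN).ne' (hf N hN)]

theorem exists_tendsto_zero_lt_one_div_rpow
    (h : ∀ ε, 0 < ε → ∀ᶠ N : ℕ in atTop, f N < (N : ℝ) ^ (-(κ - ε))) :
    ∃ η : ℕ → ℝ, Tendsto η atTop (𝓝 0) ∧ ∀ N : ℕ, 2 ≤ N → f N < 1 / (N : ℝ) ^ (κ - η N) := by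
  have hone {N : ℕ} (hN : 2 ≤ N) : (1 : ℝ) < N := Nat.one_lt_cast.2 hN
  obtain ⟨η, hη, heq⟩ := exists_tendsto_zero_eq_one_div_rpow (κ := κ)
    (f := fun N => max (f N) ((N : ℝ) ^ (-κ)))
    (fun N hN => lt_max_of_lt_right (Real.rpow_pos_of_pos (by linarith [hone hN]) _))
    (fun ε hε => by
      filter_upwards [h ε hε, eventually_ge_atTop 2] with N hlt hN
      exact max_lt hlt (Real.rpow_lt_rpow_of_exponent_lt (hone hN) (by linarith)))
    fun ε hε => by
      filter_upwards [eventually_ge_atTop 2] with N hN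
      exact le_max_of_le_right
        (Real.rpow_le_rpow_of_exponent_le (hone hN).le (by linarith))
  refine ⟨fun N => -η N + 1 / N, by simpa using hη.neg.add tendsto_one_div_atTop_nhds_zero_nat,
    fun N hN => ?_⟩
  have hN₀ : (0 : ℝ) < N := by linarith [hone hN]
  calc f N ≤ max (f N) ((N : ℝ) ^ (-κ)) := le_max_left _ _
    _ = 1 / (N : ℝ) ^ (κ + η N) := heq N hN
    _ < 1 / (N : ℝ) ^ (κ - (-η N + 1 / N)) := by
        have := Real.rpow_lt_rpow_of_exponent_lt (hone hN)
          (by linarith [one_div_pos.2 hN₀] : κ - (-η N + 1 / N) < κ + η N)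
        gcongr

end VanishingExponent

theorem pairwise_le_abs_sub_of_gap {x : ℕ → ℝ} {c : ℝ} (hc : 0 < c)
    (hgap : ∀ n : ℕ, 1 ≤ n → c ≤ x (n + 1) - x n) :
    (Set.Ici 1).Pairwise fun m n => c ≤ |x m - x n| := by
  have hlt : ∀ m n : ℕ, 1 ≤ m → m < n → c ≤ x n - x m := fun m n hm hmn => by
    induction n, hmn using Nat.le_induction with
    | base => exact hgap m hm
    | succ n hmn ih => linarith [hgap n (by omega)]
  intro m hm n hn hne
  rcases hne.lt_or_gt with h | h
  · exact abs_sub_comm (x m) (x n) ▸ (hlt m n hm h).trans (le_abs_self _)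
  · exact (hlt n m hn h).trans (le_abs_self _)

theorem theorem1p3_general (hLH : LindelofHypothesis) (x : ℕ → ℝ)
    (hsep : ∃ c : ℝ, 0 < c ∧ (Set.Ici 1).Pairwise fun m n => c ≤ |x m - x n|)
    (hgrowth : ∃ C : ℝ, x =O[atTop] (fun n : ℕ => (n : ℝ) ^ C)) :
    (∀ β : ℝ, EnergyBound x β →
      ∀ᵐ α : ℝ ∂volume, ∃ η : ℕ → ℝ, Tendsto η atTop (𝓝 0) ∧
        ∀ N : ℕ, 2 ≤ N →
          minGap (fun n => α * x n) N < 1 / (N : ℝ) ^ (4 - β - η N)) ∧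
    (EnergyBound x 2 →
      ∀ᵐ α : ℝ ∂volume, ∃ η : ℕ → ℝ, Tendsto η atTop (𝓝 0) ∧
        ∀ N : ℕ, 2 ≤ N →
          minGap (fun n => α * x n) N = 1 / (N : ℝ) ^ (2 + η N)) := by
  obtain ⟨c, hc, hsep⟩ := hsep
  have hupper (β : ℝ) (hβ : EnergyBound x β) : ∀ᵐ α : ℝ, ∀ ε, 0 < ε → ∀ᶠ N : ℕ in atTop,
      minGap (fun n => α * x n) N < (N : ℝ) ^ (-(4 - β - ε)) :=
    ae_forall_pos (fun α _ _ hle h => h.mp <| (eventually_rpow_le_rpow (by linarith)).mono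
      fun N hN hlt => hlt.trans_le hN)
      fun ε hε => hLH.ae_eventually_minGap_lt_rpow hc hsep hgrowth hβ hε
  have hlower : ∀ᵐ α : ℝ, ∀ ε : ℝ, 0 < ε → ∀ᶠ N : ℕ in atTop,
      (N : ℝ) ^ (-(2 + ε)) ≤ minGap (fun n => α * x n) N :=
    ae_forall_pos (fun α _ _ hle h => h.mp <| (eventually_rpow_le_rpow (by linarith)).mono
      fun N => le_trans) fun ε hε => ae_eventually_rpow_le_minGap hc hsep hε
  refine ⟨fun β hβ => ?_, fun hβ => ?_⟩
  · filter_upwards [hupper β hβ] with α hα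
    exact exists_tendsto_zero_lt_one_div_rpow hα
  · filter_upwards [hupper 2 hβ, hlower] with α hlt hle
    rw [show (4 - 2 : ℝ) = 2 by norm_num] at hlt
    exact exists_tendsto_zero_eq_one_div_rpow (fun N hN =>
      pos_of_antitoneOn_of_eventually_rpow_le (minGap_antitoneOn _) (hle 1 one_pos) hN) hlt hle

theorem theorem1p3 (hLH : LindelofHypothesis) (x : ℕ → ℝ)
    (hpos : ∀ n : ℕ, 1 ≤ n → 0 < x n)
    (hgap : ∃ c : ℝ, 0 < c ∧ ∀ n : ℕ, 1 ≤ n → c ≤ x (n + 1) - x n)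
    (hgrowth : ∃ C : ℝ, x =O[atTop] (fun n : ℕ => (n : ℝ) ^ C)) :
    (∀ β : ℝ, EnergyBound x β →
      ∀ᵐ α : ℝ ∂volume, ∃ η : ℕ → ℝ, Tendsto η atTop (𝓝 0) ∧
        ∀ N : ℕ, 2 ≤ N →
          minGap (fun n => α * x n) N < 1 / (N : ℝ) ^ (4 - β - η N)) ∧
    (EnergyBound x 2 →
      ∀ᵐ α : ℝ ∂volume, ∃ η : ℕ → ℝ, Tendsto η atTop (𝓝 0) ∧
        ∀ N : ℕ, 2 ≤ N →
          minGap (fun n => α * x n) N = 1 / (N : ℝ) ^ (2 + η N)) := by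
  obtain ⟨c, hc, hgap⟩ := hgap
  exact theorem1p3_general hLH x ⟨c, hc, pairwise_le_abs_sub_of_gap hc hgap⟩ hgrowth
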